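/- Let $(M,g,J)$ be a smooth almost Hermitian manifold of real dimension $2k$ (i.e. $J$ is a smooth field of endomorphisms of $TM$ with $J^2=-1$ and $g(JU,JV)=g(U,V)$), and let $L$ be a $k$-dimensional submanifold of $M$ (immersed submanifolds are allowed) that is totally real in the sense that for every $x\in L$ the tangent space splits as a direct orthogonal sum $T_xM=T_xL\oplus^{\perp}J(T_xL)$. Let $\langle\cdot,\cdot\rangle$ be the induced metric on $L$, $\pi:T^\perp L\to L$ the normal bundle with its fibre metric $\langle\cdot,\cdot\rangle^\perp$, $\nabla^\perp$ the normal connection induced by the Levi-Civita connection of $g$, and $K:T(T^\perp L)\to T^\perp L$ its connection map (so that $K(\xi_*X)=\nabla^\perp_X\xi$ and $K$ is the canonical isomorphism on vertical vectors). For $\theta\in T^\perp_xL$, $X\in T_xL$, $\xi\in T_x^\perp L$ let $X^h_\theta,\xi^v_\theta\in T_\theta(T^\perp L)$ be the horizontal and vertical lifts, i.e. $\pi_*X^h_\theta=X$, $KX^h_\theta=0$, $\pi_*\xi^v_\theta=0$, $K\xi^v_\theta=\xi$; put $\Theta_\theta=\theta^v_\theta$, $J^h_\theta=(J\theta)^h_\theta$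 and $\omega_\theta=1/(1+\langle\theta,\theta\rangle^\perp)$. For $p\in\mathbb R$ and $q\ge 0$ let $$h_{p,q}(A,B)=\langle\pi_*A,\pi_*B\rangle+\omega_\theta^p\big(\langle KA,KB\rangle^\perp+q\langle KA,\theta\rangle^\perp\langle KB,\theta\rangle^\perp\big),\qquad A,B\in T_\theta(T^\perp L).$$ Then $h_{p,q}$ is a smooth Riemannian metric on the manifold $T^\perp L$, there is exactly one field $\tilde J$ of endomorphisms of the tangent spaces of $T^\perp L$ such that $$(\tilde J\xi^v)_\theta=\omega_\theta^{p/2}\Big((J\xi)^h_\theta+\frac{q}{1+\sqrt{1+q\langle\theta,\theta\rangle^\perp}}\,\langle\xi,\theta\rangle^\perp J^h_\theta\Big),$$ $$(\tilde JX^h)_\theta=\frac1{\omega_\theta^{p/2}}\Big((JX)^v_\theta-\frac{q}{1+q\langle\theta,\theta\rangle^\perp+\sqrt{1+q\langle\theta,\theta\rangle^\perp}}\,\langle JX,\theta\rangle^\perp\,\Theta_\theta\Big)$$ for all $\theta$, $\xi$, $X$, and $(T^\perp L,h_{p,q},\tilde J)$ is an almost Hermitian manifold: $\tilde J$ is smooth,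 $\tilde J^2=-1$ and $h_{p,q}(\tilde JA,\tilde JB)=h_{p,q}(A,B)$. -/

import Mathlib

open Bundle Manifold ContDiff

set_option linter.unusedSectionVars false

noncomputable section

namespace NormalBundleGeometry

section Setting

variable {E : Type*} [NormedAddCommGroup E] [NormedSpace ℝ E]
  {M : Type*} [TopologicalSpace M] [ChartedSpace E M]
  {F : Type*} [NormedAddCommGroup F] [NormedSpace ℝ F]
  {L : Type*} [TopologicalSpace L] [ChartedSpace F L]

/-- Smooth Riemannian metrics on the tangent bundle of a manifold `M` modelled on `E`. -/
abbrev Metric (E : Type*) [NormedAddCommGroup E] [NormedSpace ℝ E]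
    (M : Type*) [TopologicalSpace M] [ChartedSpace E M] [IsManifold 𝓘(ℝ, E) ∞ M] :=
  ContMDiffRiemannianMetric 𝓘(ℝ, E) ∞ E (fun x : M => TangentSpace 𝓘(ℝ, E) x)

/-- Smooth immersions of `L` (modelled on `F`) into `M` (modelled on `E`). -/
structure Immersion (E F L M : Type*) [NormedAddCommGroup E] [NormedSpace ℝ E]
    [TopologicalSpace M] [ChartedSpace E M] [NormedAddCommGroup F] [NormedSpace ℝ F]
    [TopologicalSpace L] [ChartedSpace F L] where
  /-- the underlying map -/
  map : L → M
  contMDiff : ContMDiff 𝓘(ℝ, F) 𝓘(ℝ, E) ∞ map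
  injective : ∀ x, Function.Injective (mfderiv 𝓘(ℝ, F) 𝓘(ℝ, E) map x)

/-- The differential `T_x L → T_{f x} M` of an immersion. -/
def Immersion.d (f : Immersion E F L M) (x : L) :
    TangentSpace 𝓘(ℝ, F) x →L[ℝ] TangentSpace 𝓘(ℝ, E) (f.map x) :=
  mfderiv 𝓘(ℝ, F) 𝓘(ℝ, E) f.map x

variable [FiniteDimensional ℝ E] [FiniteDimensional ℝ F]
  [IsManifold 𝓘(ℝ, E) ∞ M] [IsManifold 𝓘(ℝ, F) ∞ L]

instance {x : M} : FiniteDimensional ℝ (TangentSpace 𝓘(ℝ, E) x) :=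
  inferInstanceAs (FiniteDimensional ℝ E)

instance {x : M} : T2Space (TangentSpace 𝓘(ℝ, E) x) :=
  inferInstanceAs (T2Space E)

/-- The covector `X ↦ g(v, df X)` on `T_x L` attached to a vector `v` of `T_{f x} M`. -/
def restrictedInner (g : Metric E M) (f : Immersion E F L M) (x : L) :
    TangentSpace 𝓘(ℝ, E) (f.map x) →L[ℝ] TangentSpace 𝓘(ℝ, F) x →L[ℝ] ℝ :=
  (ContinuousLinearMap.precomp ℝ (f.d x)).comp (g.inner (f.map x))

theorem restrictedInner_apply (g : Metric E M) (f : Immersion E F L M) (x : L)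
    (v : TangentSpace 𝓘(ℝ, E) (f.map x)) (X : TangentSpace 𝓘(ℝ, F) x) :
    restrictedInner g f x v X = g.inner (f.map x) v (f.d x X) := rfl

/-- The Riemannian metric `⟨X, Y⟩ = g(df X, df Y)` induced on `L`. -/
def inducedMetric (g : Metric E M) (f : Immersion E F L M) (x : L) :
    TangentSpace 𝓘(ℝ, F) x →L[ℝ] TangentSpace 𝓘(ℝ, F) x →L[ℝ] ℝ :=
  (restrictedInner g f x).comp (f.d x)

theorem inducedMetric_apply (g : Metric E M) (f : Immersion E F L M) (x : L)
    (X Y : TangentSpace 𝓘(ℝ, F) x) :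
    inducedMetric g f x X Y = g.inner (f.map x) (f.d x X) (f.d x Y) := rfl

/-- An injective linear map between finite-dimensional spaces of the same dimension is invertible. -/
theorem isInvertible_of_injective {V W : Type*} [AddCommGroup V] [Module ℝ V] [TopologicalSpace V]
    [IsTopologicalAddGroup V] [ContinuousSMul ℝ V] [T2Space V] [FiniteDimensional ℝ V]
    [AddCommGroup W] [Module ℝ W] [TopologicalSpace W]
    [IsTopologicalAddGroup W] [ContinuousSMul ℝ W] [T2Space W] [FiniteDimensional ℝ W]
    (A : V →L[ℝ] W) (hA : Function.Injective A)
    (h : Module.finrank ℝ V = Module.finrank ℝ W) : A.IsInvertible := by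
  let e : V ≃ₗ[ℝ] W := LinearEquiv.ofInjectiveOfFinrankEq A.toLinearMap hA h
  refine ⟨e.toContinuousLinearEquiv, ?_⟩
  ext v
  rfl

theorem finrank_dual (V : Type*) [AddCommGroup V] [Module ℝ V] [TopologicalSpace V]
    [IsTopologicalAddGroup V] [ContinuousSMul ℝ V] [T2Space V] [FiniteDimensional ℝ V] :
    Module.finrank ℝ (V →L[ℝ] ℝ) = Module.finrank ℝ V := by
  rw [← (LinearMap.toContinuousLinearMap (𝕜 := ℝ) (E := V) (F' := ℝ)).finrank_eq]
  exact Subspace.dual_finrank_eq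

theorem inner_isInvertible (g : Metric E M) (y : M) : (g.inner y).IsInvertible := by
  have : FiniteDimensional ℝ (TangentSpace 𝓘(ℝ, E) y →L[ℝ] ℝ) :=
    inferInstanceAs (FiniteDimensional ℝ (E →L[ℝ] ℝ))
  refine isInvertible_of_injective _ ?_ (finrank_dual _).symm
  refine (injective_iff_map_eq_zero _).2 fun v hv => ?_
  by_contra h
  have := g.pos y v h
  rw [hv] at this
  exact lt_irrefl _ this

theorem inducedMetric_isInvertible (g : Metric E M) (f : Immersion E F L M) (x : L) :
    (inducedMetric g f x).IsInvertible := by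
  have : FiniteDimensional ℝ (TangentSpace 𝓘(ℝ, F) x →L[ℝ] ℝ) :=
    inferInstanceAs (FiniteDimensional ℝ (F →L[ℝ] ℝ))
  refine isInvertible_of_injective _ ?_ (finrank_dual _).symm
  refine (injective_iff_map_eq_zero _).2 fun v hv => ?_
  by_contra h
  have := g.pos (f.map x) (f.d x v) fun h0 => h (f.injective x (h0.trans (map_zero (f.d x)).symm))
  have h2 : inducedMetric g f x v v = 0 := by rw [hv]; rfl
  rw [inducedMetric_apply] at h2
  exact this.ne' h2

/-- The tangential part of `v ∈ T_{f x} M`: the vector `X ∈ T_x L` such that `v - df X` is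
orthogonal to the image of `df`. -/
def tangentialPart (g : Metric E M) (f : Immersion E F L M) (x : L) :
    TangentSpace 𝓘(ℝ, E) (f.map x) →L[ℝ] TangentSpace 𝓘(ℝ, F) x :=
  (inducedMetric g f x).inverse.comp (restrictedInner g f x)

/-- The normal space `T_x^⊥ L`: the vectors of `T_{f x} M` that are orthogonal to `df(T_x L)`. -/
def NormalSpace (g : Metric E M) (f : Immersion E F L M) (x : L) :
    Submodule ℝ (TangentSpace 𝓘(ℝ, E) (f.map x)) :=
  LinearMap.ker (restrictedInner g f x).toLinearMap

theorem mem_normalSpace {g : Metric E M} {f : Immersion E F L M} {x : L}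
    {v : TangentSpace 𝓘(ℝ, E) (f.map x)} :
    v ∈ NormalSpace g f x ↔ ∀ X : TangentSpace 𝓘(ℝ, F) x, g.inner (f.map x) v (f.d x X) = 0 := by
  unfold NormalSpace
  rw [LinearMap.mem_ker]
  constructor
  · intro h X
    rw [← restrictedInner_apply]
    exact congrArg (fun l : TangentSpace 𝓘(ℝ, F) x →L[ℝ] ℝ => l X) h
  · intro h
    ext X
    exact h X

theorem inner_tangentialPart (g : Metric E M) (f : Immersion E F L M) (x : L)
    (v : TangentSpace 𝓘(ℝ, E) (f.map x)) (X : TangentSpace 𝓘(ℝ, F) x) :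
    g.inner (f.map x) (f.d x (tangentialPart g f x v)) (f.d x X) =
      g.inner (f.map x) v (f.d x X) := by
  have h := (inducedMetric_isInvertible g f x).self_apply_inverse (restrictedInner g f x v)
  exact congrArg (fun l : TangentSpace 𝓘(ℝ, F) x →L[ℝ] ℝ => l X) h

/-- The orthogonal projection `T_{f x} M → T_x^⊥ L`. -/
def normalPart (g : Metric E M) (f : Immersion E F L M) (x : L) :
    TangentSpace 𝓘(ℝ, E) (f.map x) →L[ℝ] NormalSpace g f x :=
  (ContinuousLinearMap.id ℝ _ - (f.d x).comp (tangentialPart g f x)).codRestrict _ fun v => by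
    rw [mem_normalSpace]
    intro X
    have := inner_tangentialPart g f x v X
    simp [this]

theorem coe_normalPart (g : Metric E M) (f : Immersion E F L M) (x : L)
    (v : TangentSpace 𝓘(ℝ, E) (f.map x)) :
    (normalPart g f x v : TangentSpace 𝓘(ℝ, E) (f.map x)) =
      v - f.d x (tangentialPart g f x v) := rfl

theorem tangentialPart_eq_zero (g : Metric E M) (f : Immersion E F L M) (x : L)
    {v : TangentSpace 𝓘(ℝ, E) (f.map x)} (hv : v ∈ NormalSpace g f x) :
    tangentialPart g f x v = 0 := by
  have : restrictedInner g f x v = 0 := hv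
  simp [tangentialPart, this]

theorem normalPart_coe (g : Metric E M) (f : Immersion E F L M) (x : L) (v : NormalSpace g f x) :
    normalPart g f x (v : TangentSpace 𝓘(ℝ, E) (f.map x)) = v := by
  apply Subtype.ext
  rw [coe_normalPart, tangentialPart_eq_zero g f x v.2, map_zero, sub_zero]

theorem finrank_normalSpace (g : Metric E M) (f : Immersion E F L M) (x : L) :
    Module.finrank ℝ (NormalSpace g f x) = Module.finrank ℝ E - Module.finrank ℝ F := by
  have h1 := LinearMap.finrank_range_add_finrank_ker (restrictedInner g f x).toLinearMap
  have h2 : LinearMap.range (restrictedInner g f x).toLinearMap = ⊤ := by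
    rw [LinearMap.range_eq_top]
    intro l
    obtain ⟨X, hX⟩ := (inducedMetric_isInvertible g f x).surjective l
    exact ⟨f.d x X, hX⟩
  rw [h2, finrank_top, finrank_dual] at h1
  have h3 : Module.finrank ℝ (TangentSpace 𝓘(ℝ, E) (f.map x)) = Module.finrank ℝ E := rfl
  have h4 : Module.finrank ℝ (TangentSpace 𝓘(ℝ, F) x) = Module.finrank ℝ F := rfl
  unfold NormalSpace
  omega

/-- The model fibre of the normal bundle, of dimension `dim M - dim L`. -/
abbrev NormalModel (E F : Type*) [NormedAddCommGroup E] [NormedSpace ℝ E]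
    [NormedAddCommGroup F] [NormedSpace ℝ F] :=
  EuclideanSpace ℝ (Fin (Module.finrank ℝ E - Module.finrank ℝ F))

theorem finrank_le (f : Immersion E F L M) (x : L) :
    Module.finrank ℝ F ≤ Module.finrank ℝ E :=
  LinearMap.finrank_le_finrank_of_injective (f := (f.d x).toLinearMap) (f.injective x)

/-- A linear identification of one normal space with the model fibre. -/
def normalSpaceEquiv (g : Metric E M) (f : Immersion E F L M) (x : L) :
    NormalSpace g f x ≃L[ℝ] NormalModel E F :=
  ContinuousLinearEquiv.ofFinrankEq (by rw [finrank_normalSpace, finrank_euclideanSpace_fin])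

end Setting

section NormalBundle

variable {E : Type*} [NormedAddCommGroup E] [NormedSpace ℝ E]
  {M : Type*} [TopologicalSpace M] [ChartedSpace E M]
  {F : Type*} [NormedAddCommGroup F] [NormedSpace ℝ F]
  {L : Type*} [TopologicalSpace L] [ChartedSpace F L]
  [FiniteDimensional ℝ E] [FiniteDimensional ℝ F]
  [IsManifold 𝓘(ℝ, E) ∞ M] [IsManifold 𝓘(ℝ, F) ∞ L]

/-- The trivialization of the tangent bundle of `M` given by the preferred chart at `y`. -/
abbrev chartTriv (E : Type*) [NormedAddCommGroup E] [NormedSpace ℝ E]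
    {M : Type*} [TopologicalSpace M] [ChartedSpace E M] [IsManifold 𝓘(ℝ, E) ∞ M] (y : M) :=
  trivializationAt E (fun z : M => TangentSpace 𝓘(ℝ, E) z) y

/-- The fixed projection of the model space onto the model fibre, with kernel the tangent space of
`L` at `x₀` (read in the preferred chart of `M` at `f x₀`). -/
def baseProj (g : Metric E M) (f : Immersion E F L M) (x₀ : L) : E →L[ℝ] NormalModel E F :=
  ((normalSpaceEquiv g f x₀ : NormalSpace g f x₀ →L[ℝ] NormalModel E F).comp
    (normalPart g f x₀)).comp ((chartTriv E (f.map x₀)).symmL ℝ (f.map x₀))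

/-- In the chart of `M` at `f x₀` and the chart of `L` at `x₀`, the linear map sending `u` to its
image under `baseProj` and to the covector `w ↦ g(u, df w)`. -/
def frameMap (g : Metric E M) (f : Immersion E F L M) (x₀ x : L) :
    E →L[ℝ] NormalModel E F × (F →L[ℝ] ℝ) :=
  (baseProj g f x₀).prod
    ((ContinuousLinearMap.precomp ℝ ((chartTriv F x₀).symmL ℝ x)).comp
      ((restrictedInner g f x).comp ((chartTriv E (f.map x₀)).symmL ℝ (f.map x))))

theorem frameMap_fst (g : Metric E M) (f : Immersion E F L M) (x₀ x : L) (u : E) :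
    (frameMap g f x₀ x u).1 = baseProj g f x₀ u := rfl

theorem frameMap_snd (g : Metric E M) (f : Immersion E F L M) (x₀ x : L) (u : E) (w : F) :
    (frameMap g f x₀ x u).2 w =
      g.inner (f.map x) ((chartTriv E (f.map x₀)).symmL ℝ (f.map x) u)
        (f.d x ((chartTriv F x₀).symmL ℝ x w)) := rfl

/-- The open set on which both charts are defined. -/
def chartDom (f : Immersion E F L M) (x₀ : L) : Set L :=
  (chartTriv F x₀).baseSet ∩ f.map ⁻¹' (chartTriv E (f.map x₀)).baseSet

theorem isOpen_chartDom (f : Immersion E F L M) (x₀ : L) : IsOpen (chartDom f x₀) :=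
  (chartTriv F x₀).open_baseSet.inter
    ((chartTriv E (f.map x₀)).open_baseSet.preimage f.contMDiff.continuous)

/-- A map into linear maps on a finite-dimensional space is smooth if its values are. -/
theorem contMDiffOn_clm_of_apply {V W : Type*} [NormedAddCommGroup V] [NormedSpace ℝ V]
    [FiniteDimensional ℝ V] [NormedAddCommGroup W] [NormedSpace ℝ W]
    {C : L → V →L[ℝ] W} {s : Set L}
    (h : ∀ v, ContMDiffOn 𝓘(ℝ, F) 𝓘(ℝ, W) ∞ (fun x => C x v) s) :
    ContMDiffOn 𝓘(ℝ, F) 𝓘(ℝ, V →L[ℝ] W) ∞ C s := by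
  let b := Module.finBasis ℝ V
  have key : ∀ x, C x = ∑ i, ContinuousLinearMap.smulRightL ℝ V W
      (LinearMap.toContinuousLinearMap (b.coord i)) (C x (b i)) := by
    intro x
    ext v
    conv_lhs => rw [← b.sum_repr v, map_sum]
    simp
  refine ContMDiffOn.congr (f := fun x => ∑ i, ContinuousLinearMap.smulRightL ℝ V W
      (LinearMap.toContinuousLinearMap (b.coord i)) (C x (b i))) ?_ fun x _ => key x
  refine contMDiffOn_finsetSum fun i _ => ?_
  exact (ContinuousLinearMap.contMDiff _).comp_contMDiffOn (h (b i))

theorem contMDiffOn_symmL_apply (y : M) (u : E) :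
    ContMDiffOn 𝓘(ℝ, E) (𝓘(ℝ, E).prod 𝓘(ℝ, E)) ∞
      (fun z => (TotalSpace.mk' E z ((chartTriv E y).symmL ℝ z u) :
        TotalSpace E (fun z : M => TangentSpace 𝓘(ℝ, E) z))) (chartTriv E y).baseSet := by
  rw [Trivialization.contMDiffOn_section_baseSet_iff]
  refine (contMDiffOn_const (c := u)).congr fun z hz => ?_
  have := (chartTriv E y).continuousLinearMapAt_symmL (R := ℝ) hz u
  rwa [Trivialization.continuousLinearMapAt_apply, Trivialization.linearMapAt_apply,
    if_pos hz] at this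

theorem contMDiffOn_frameMap (g : Metric E M) (f : Immersion E F L M) (x₀ : L) :
    ContMDiffOn 𝓘(ℝ, F) 𝓘(ℝ, E →L[ℝ] NormalModel E F × (F →L[ℝ] ℝ)) ∞ (frameMap g f x₀)
      (chartDom f x₀) := by
  refine contMDiffOn_clm_of_apply fun u => ?_
  refine ContMDiffOn.prodMk_space (f := fun _ => baseProj g f x₀ u) contMDiffOn_const ?_
  refine contMDiffOn_clm_of_apply fun w => ?_
  have hs : ContMDiffOn 𝓘(ℝ, F) (𝓘(ℝ, E).prod 𝓘(ℝ, E)) ∞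
      (fun x => (TotalSpace.mk' E (f.map x) ((chartTriv E (f.map x₀)).symmL ℝ (f.map x) u) :
        TotalSpace E (fun z : M => TangentSpace 𝓘(ℝ, E) z))) (chartDom f x₀) :=
    (contMDiffOn_symmL_apply (f.map x₀) u).comp f.contMDiff.contMDiffOn fun x hx => hx.2
  have ht : ContMDiffOn 𝓘(ℝ, F) (𝓘(ℝ, E).prod 𝓘(ℝ, E)) ∞
      (fun x => (TotalSpace.mk' E (f.map x) (f.d x ((chartTriv F x₀).symmL ℝ x w)) :
        TotalSpace E (fun z : M => TangentSpace 𝓘(ℝ, E) z))) (chartDom f x₀) :=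
    (f.contMDiff.contMDiff_tangentMap (m := ∞) le_rfl).comp_contMDiffOn
      ((contMDiffOn_symmL_apply x₀ w).mono fun x hx => hx.1)
  have hg : ContMDiffOn 𝓘(ℝ, F) (𝓘(ℝ, E).prod 𝓘(ℝ, E →L[ℝ] E →L[ℝ] ℝ)) ∞
      (fun x => TotalSpace.mk' (E →L[ℝ] E →L[ℝ] ℝ)
        (E := fun z : M => TangentSpace 𝓘(ℝ, E) z →L[ℝ] TangentSpace 𝓘(ℝ, E) z →L[ℝ] ℝ)
        (f.map x) (g.inner (f.map x)))
      (chartDom f x₀) :=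
    (g.contMDiff.comp f.contMDiff).contMDiffOn
  have := ContMDiffOn.clm_bundle_apply₂ (F₁ := E) (F₂ := E) (F₃ := ℝ)
    (E₃ := Bundle.Trivial M ℝ) hg hs ht
  intro x hx
  have h2 := this x hx
  rw [contMDiffWithinAt_totalSpace] at h2
  exact h2.2

theorem finrank_prod_model (f : Immersion E F L M) (x : L) :
    Module.finrank ℝ E = Module.finrank ℝ (NormalModel E F × (F →L[ℝ] ℝ)) := by
  rw [Module.finrank_prod, finrank_dual, finrank_euclideanSpace_fin]
  have := finrank_le f x
  omega

theorem frameMap_self_isInvertible (g : Metric E M) (f : Immersion E F L M) (x₀ : L) :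
    (frameMap g f x₀ x₀).IsInvertible := by
  refine isInvertible_of_injective _ ?_ (finrank_prod_model f x₀)
  refine (injective_iff_map_eq_zero _).2 fun u hu => ?_
  have hE : f.map x₀ ∈ (chartTriv E (f.map x₀)).baseSet :=
    mem_baseSet_trivializationAt _ _ _
  have hF : x₀ ∈ (chartTriv F x₀).baseSet :=
    mem_baseSet_trivializationAt _ _ _
  have h1 : baseProj g f x₀ u = 0 := by rw [← frameMap_fst, hu]; rfl
  have h2 : ∀ w, g.inner (f.map x₀) ((chartTriv E (f.map x₀)).symmL ℝ (f.map x₀) u)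
        (f.d x₀ ((chartTriv F x₀).symmL ℝ x₀ w)) = 0 := by
    intro w
    rw [← frameMap_snd, hu]; rfl
  have h3 : normalPart g f x₀ ((chartTriv E (f.map x₀)).symmL ℝ (f.map x₀) u) = 0 :=
    (normalSpaceEquiv g f x₀).injective (h1.trans (map_zero _).symm)
  have h4 : (chartTriv E (f.map x₀)).symmL ℝ (f.map x₀) u ∈ NormalSpace g f x₀ := by
    rw [mem_normalSpace]
    intro X
    have := h2 ((chartTriv F x₀).continuousLinearMapAt ℝ x₀ X)
    rwa [(chartTriv F x₀).symmL_continuousLinearMapAt hF] at this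
  have h5 := normalPart_coe g f x₀ ⟨_, h4⟩
  rw [h3] at h5
  have h6 : (chartTriv E (f.map x₀)).symmL ℝ (f.map x₀) u = 0 := (congrArg Subtype.val h5).symm
  rw [← (chartTriv E (f.map x₀)).continuousLinearMapAt_symmL (R := ℝ) hE u, h6, map_zero]

/-- The domain of the local trivialization of the normal bundle around `x₀`. -/
def normalDom (g : Metric E M) (f : Immersion E F L M) (x₀ : L) : Set L :=
  chartDom f x₀ ∩ {x | (frameMap g f x₀ x).IsInvertible}

theorem isOpen_normalDom (g : Metric E M) (f : Immersion E F L M) (x₀ : L) :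
    IsOpen (normalDom g f x₀) :=
  (contMDiffOn_frameMap g f x₀).continuousOn.isOpen_inter_preimage (isOpen_chartDom f x₀)
    ContinuousLinearEquiv.isOpen

theorem mem_normalDom (g : Metric E M) (f : Immersion E F L M) (x₀ : L) :
    x₀ ∈ normalDom g f x₀ :=
  ⟨⟨mem_baseSet_trivializationAt _ _ _,
      mem_baseSet_trivializationAt E (fun z : M => TangentSpace 𝓘(ℝ, E) z) (f.map x₀)⟩,
    frameMap_self_isInvertible g f x₀⟩

/-- The local trivialization of the normal bundle around `x₀`, fibrewise. -/
def fibreTo (g : Metric E M) (f : Immersion E F L M) (x₀ x : L) :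
    NormalSpace g f x →L[ℝ] NormalModel E F :=
  (baseProj g f x₀).comp
    (((chartTriv E (f.map x₀)).continuousLinearMapAt ℝ (f.map x)).comp (NormalSpace g f x).subtypeL)

/-- The inverse of `fibreTo`. -/
def fibreFrom (g : Metric E M) (f : Immersion E F L M) (x₀ x : L) :
    NormalModel E F →L[ℝ] NormalSpace g f x :=
  (normalPart g f x).comp (((chartTriv E (f.map x₀)).symmL ℝ (f.map x)).comp
    ((frameMap g f x₀ x).inverse.comp (ContinuousLinearMap.inl ℝ (NormalModel E F) (F →L[ℝ] ℝ))))

theorem frameMap_fibre (g : Metric E M) (f : Immersion E F L M) {x₀ x : L}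
    (hx : x ∈ normalDom g f x₀) (v : NormalSpace g f x) :
    frameMap g f x₀ x ((chartTriv E (f.map x₀)).continuousLinearMapAt ℝ (f.map x) v) =
      (fibreTo g f x₀ x v, 0) := by
  refine Prod.ext rfl ?_
  ext w
  rw [frameMap_snd, (chartTriv E (f.map x₀)).symmL_continuousLinearMapAt hx.1.2]
  exact mem_normalSpace.1 v.2 _

theorem fibreFrom_fibreTo (g : Metric E M) (f : Immersion E F L M) {x₀ x : L}
    (hx : x ∈ normalDom g f x₀) (v : NormalSpace g f x) :
    fibreFrom g f x₀ x (fibreTo g f x₀ x v) = v := by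
  have h1 : (frameMap g f x₀ x).inverse (fibreTo g f x₀ x v, 0) =
      (chartTriv E (f.map x₀)).continuousLinearMapAt ℝ (f.map x) v := by
    rw [← frameMap_fibre g f hx v, ContinuousLinearMap.IsInvertible.inverse_apply_self hx.2]
  change normalPart g f x ((chartTriv E (f.map x₀)).symmL ℝ (f.map x)
    ((frameMap g f x₀ x).inverse (fibreTo g f x₀ x v, 0))) = v
  rw [h1, (chartTriv E (f.map x₀)).symmL_continuousLinearMapAt hx.1.2, normalPart_coe]

theorem coe_fibreFrom (g : Metric E M) (f : Immersion E F L M) {x₀ x : L}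
    (hx : x ∈ normalDom g f x₀) (w : NormalModel E F) :
    (fibreFrom g f x₀ x w : TangentSpace 𝓘(ℝ, E) (f.map x)) =
      (chartTriv E (f.map x₀)).symmL ℝ (f.map x) ((frameMap g f x₀ x).inverse (w, 0)) := by
  set u : E := (frameMap g f x₀ x).inverse (w, 0) with hu
  have h1 : frameMap g f x₀ x u = (w, 0) :=
    ContinuousLinearMap.IsInvertible.self_apply_inverse hx.2 _
  have h4 : (chartTriv E (f.map x₀)).symmL ℝ (f.map x) u ∈ NormalSpace g f x := by
    rw [mem_normalSpace]
    intro X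
    have := frameMap_snd g f x₀ x u ((chartTriv F x₀).continuousLinearMapAt ℝ x X)
    rw [(chartTriv F x₀).symmL_continuousLinearMapAt hx.1.1, h1] at this
    exact this.symm
  exact congrArg Subtype.val (normalPart_coe g f x ⟨_, h4⟩)

theorem fibreTo_fibreFrom (g : Metric E M) (f : Immersion E F L M) {x₀ x : L}
    (hx : x ∈ normalDom g f x₀) (w : NormalModel E F) :
    fibreTo g f x₀ x (fibreFrom g f x₀ x w) = w := by
  have h1 : frameMap g f x₀ x ((frameMap g f x₀ x).inverse (w, 0)) = (w, 0) :=
    ContinuousLinearMap.IsInvertible.self_apply_inverse hx.2 _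
  change baseProj g f x₀ ((chartTriv E (f.map x₀)).continuousLinearMapAt ℝ (f.map x)
    (fibreFrom g f x₀ x w : TangentSpace 𝓘(ℝ, E) (f.map x))) = w
  rw [coe_fibreFrom g f hx, (chartTriv E (f.map x₀)).continuousLinearMapAt_symmL hx.1.2,
    ← frameMap_fst g f x₀ x, h1]

/-- The fibres of the normal bundle `T^⊥ L`. -/
abbrev NormalFibre (g : Metric E M) (f : Immersion E F L M) (x : L) : Type _ :=
  NormalSpace g f x

/-- The local trivialization of the normal bundle around `x₀`. -/
def normalPretriv (g : Metric E M) (f : Immersion E F L M) (x₀ : L) :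
    Pretrivialization (NormalModel E F) (π (NormalModel E F) (NormalFibre g f)) where
  toFun v := ⟨v.1, fibreTo g f x₀ v.1 v.2⟩
  invFun w := ⟨w.1, fibreFrom g f x₀ w.1 w.2⟩
  source := TotalSpace.proj ⁻¹' normalDom g f x₀
  target := normalDom g f x₀ ×ˢ Set.univ
  map_source' _ h := ⟨h, Set.mem_univ _⟩
  map_target' _ h := h.1
  left_inv' := fun ⟨x, v⟩ h => by
    simp only [TotalSpace.mk_inj]
    exact fibreFrom_fibreTo g f h v
  right_inv' := fun ⟨x, w⟩ h => by
    simp only [Prod.mk_right_inj]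
    exact fibreTo_fibreFrom g f h.1 w
  open_target := (isOpen_normalDom g f x₀).prod isOpen_univ
  baseSet := normalDom g f x₀
  open_baseSet := isOpen_normalDom g f x₀
  source_eq := rfl
  target_eq := rfl
  proj_toFun _ _ := rfl

instance (g : Metric E M) (f : Immersion E F L M) (x₀ : L) : (normalPretriv g f x₀).IsLinear ℝ where
  linear x _ :=
    { map_add := fun v w => (fibreTo g f x₀ x).map_add v w
      map_smul := fun c v => (fibreTo g f x₀ x).map_smul c v }

theorem normalPretriv_symm (g : Metric E M) (f : Immersion E F L M) {x₀ x : L}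
    (hx : x ∈ normalDom g f x₀) (w : NormalModel E F) :
    (normalPretriv g f x₀).symm x w = fibreFrom g f x₀ x w := by
  rw [Pretrivialization.symm_apply _ hx]
  rfl

/-- The coordinate changes of the normal bundle. -/
def normalCoordChange (g : Metric E M) (f : Immersion E F L M) (x₀ x₁ x : L) :
    NormalModel E F →L[ℝ] NormalModel E F :=
  (fibreTo g f x₁ x).comp (fibreFrom g f x₀ x)

theorem contMDiffOn_normalCoordChange (g : Metric E M) (f : Immersion E F L M) (x₀ x₁ : L) :
    ContMDiffOn 𝓘(ℝ, F) 𝓘(ℝ, NormalModel E F →L[ℝ] NormalModel E F) ∞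
      (normalCoordChange g f x₀ x₁) (normalDom g f x₀ ∩ normalDom g f x₁) := by
  have h1 : ContMDiffOn 𝓘(ℝ, F) 𝓘(ℝ, NormalModel E F × (F →L[ℝ] ℝ) →L[ℝ] E) ∞
      (fun x => (frameMap g f x₀ x).inverse) (normalDom g f x₀ ∩ normalDom g f x₁) := by
    intro x hx
    have ha : ContDiffAt ℝ ∞ ContinuousLinearMap.inverse (frameMap g f x₀ x) :=
      ContinuousLinearMap.IsInvertible.contDiffAt_map_inverse hx.1.2
    exact ha.contMDiffAt.comp_contMDiffWithinAt x
      ((contMDiffOn_frameMap g f x₀ x hx.1.1).mono fun y hy => hy.1.1)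
  have h2 : ContMDiffOn 𝓘(ℝ, F) 𝓘(ℝ, E →L[ℝ] E) ∞
      (fun x => ((chartTriv E (f.map x₀)).coordChangeL ℝ (chartTriv E (f.map x₁)) (f.map x) :
        E →L[ℝ] E)) (normalDom g f x₀ ∩ normalDom g f x₁) :=
    (contMDiffOn_coordChangeL (IB := 𝓘(ℝ, E)) (n := ∞) (chartTriv E (f.map x₀))
      (chartTriv E (f.map x₁))).comp f.contMDiff.contMDiffOn fun x hx => ⟨hx.1.1.2, hx.2.1.2⟩
  have h3 : ContMDiffOn 𝓘(ℝ, F) 𝓘(ℝ, NormalModel E F →L[ℝ] NormalModel E F) ∞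
      (fun x => (baseProj g f x₁).comp
        (((chartTriv E (f.map x₀)).coordChangeL ℝ (chartTriv E (f.map x₁)) (f.map x) :
          E →L[ℝ] E).comp ((frameMap g f x₀ x).inverse.comp
            (ContinuousLinearMap.inl ℝ (NormalModel E F) (F →L[ℝ] ℝ)))))
      (normalDom g f x₀ ∩ normalDom g f x₁) :=
    (contMDiffOn_const).clm_comp (h2.clm_comp (h1.clm_comp contMDiffOn_const))
  refine h3.congr fun x hx => ?_
  ext1 w
  change baseProj g f x₁ ((chartTriv E (f.map x₁)).continuousLinearMapAt ℝ (f.map x)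
    (fibreFrom g f x₀ x w : TangentSpace 𝓘(ℝ, E) (f.map x))) =
      baseProj g f x₁ ((chartTriv E (f.map x₀)).coordChangeL ℝ (chartTriv E (f.map x₁)) (f.map x)
        ((frameMap g f x₀ x).inverse (w, 0)))
  rw [coe_fibreFrom g f hx.1]
  congr 1
  have h4 : f.map x ∈ (chartTriv E (f.map x₁)).baseSet := hx.2.1.2
  rw [Trivialization.coordChangeL_apply _ _ ⟨hx.1.1.2, hx.2.1.2⟩,
    Trivialization.continuousLinearMapAt_apply, Trivialization.linearMapAt_apply, if_pos h4,
    Trivialization.symmL_apply _ hx.1.1.2]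

/-- The normal bundle as a vector prebundle. -/
def normalPrebundle (g : Metric E M) (f : Immersion E F L M) :
    VectorPrebundle ℝ (NormalModel E F) (NormalFibre g f) where
  pretrivializationAtlas := Set.range (normalPretriv g f)
  pretrivialization_linear' := by
    rintro _ ⟨x₀, rfl⟩
    infer_instance
  pretrivializationAt := normalPretriv g f
  mem_base_pretrivializationAt := mem_normalDom g f
  pretrivialization_mem_atlas x := ⟨x, rfl⟩
  exists_coordChange := by
    rintro _ ⟨x₀, rfl⟩ _ ⟨x₁, rfl⟩
    refine ⟨normalCoordChange g f x₀ x₁, (contMDiffOn_normalCoordChange g f x₀ x₁).continuousOn,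
      fun x hx w => ?_⟩
    rw [normalPretriv_symm g f hx.1]
    rfl
  totalSpaceMk_isInducing x := by
    let φ : NormalFibre g f x ≃L[ℝ] NormalModel E F :=
      ContinuousLinearEquiv.equivOfInverse (fibreTo g f x x) (fibreFrom g f x x)
        (fibreFrom_fibreTo g f (mem_normalDom g f x)) (fibreTo_fibreFrom g f (mem_normalDom g f x))
    exact Topology.isInducing_const_prod.mpr φ.toHomeomorph.isInducing

instance (g : Metric E M) (f : Immersion E F L M) :
    (normalPrebundle g f).IsContMDiff 𝓘(ℝ, F) ∞ where
  exists_contMDiffCoordChange := by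
    rintro _ ⟨x₀, rfl⟩ _ ⟨x₁, rfl⟩
    refine ⟨normalCoordChange g f x₀ x₁, contMDiffOn_normalCoordChange g f x₀ x₁,
      fun x hx w => ?_⟩
    rw [normalPretriv_symm g f hx.1]
    rfl

instance (g : Metric E M) (f : Immersion E F L M) :
    TopologicalSpace (TotalSpace (NormalModel E F) (NormalFibre g f)) :=
  (normalPrebundle g f).totalSpaceTopology

instance (g : Metric E M) (f : Immersion E F L M) :
    FiberBundle (NormalModel E F) (NormalFibre g f) :=
  (normalPrebundle g f).toFiberBundle

instance (g : Metric E M) (f : Immersion E F L M) :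
    VectorBundle ℝ (NormalModel E F) (NormalFibre g f) :=
  (normalPrebundle g f).toVectorBundle

instance (g : Metric E M) (f : Immersion E F L M) :
    ContMDiffVectorBundle ∞ (NormalModel E F) (NormalFibre g f) 𝓘(ℝ, F) :=
  (normalPrebundle g f).contMDiffVectorBundle 𝓘(ℝ, F)

/-- The total space `T^⊥ L` of the normal bundle; it carries the manifold structure of a smooth
vector bundle over `L`. -/
abbrev NormalBundle (g : Metric E M) (f : Immersion E F L M) : Type _ :=
  TotalSpace (NormalModel E F) (NormalFibre g f)

end NormalBundle

section Connection

set_option synthInstance.maxHeartbeats 400000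

variable {E : Type*} [NormedAddCommGroup E] [NormedSpace ℝ E]
  {M : Type*} [TopologicalSpace M] [ChartedSpace E M]
  {F : Type*} [NormedAddCommGroup F] [NormedSpace ℝ F]
  {L : Type*} [TopologicalSpace L] [ChartedSpace F L]
  [FiniteDimensional ℝ E] [FiniteDimensional ℝ F]
  [IsManifold 𝓘(ℝ, E) ∞ M] [IsManifold 𝓘(ℝ, F) ∞ L]

/-- The metric of `M` read in the preferred chart at `x`: a function on the model space with values
in the bilinear forms (its components are the usual `g_ij`). -/
def localMetric (g : Metric E M) (x : M) (y : E) : E →L[ℝ] E →L[ℝ] ℝ :=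
  (ContinuousLinearMap.precomp ℝ
      ((chartTriv E x).symmL ℝ ((extChartAt 𝓘(ℝ, E) x).symm y))).comp
    ((g.inner ((extChartAt 𝓘(ℝ, E) x).symm y)).comp
      ((chartTriv E x).symmL ℝ ((extChartAt 𝓘(ℝ, E) x).symm y)))

/-- The derivative at `x` of the metric read in the preferred chart at `x`:
`metricDeriv g x a v w = ∂_a g(v, w)`. -/
def metricDeriv (g : Metric E M) (x : M) : E →L[ℝ] E →L[ℝ] E →L[ℝ] ℝ :=
  fderiv ℝ (E := E) (F := E →L[ℝ] E →L[ℝ] ℝ) (localMetric g x) (extChartAt 𝓘(ℝ, E) x x)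

/-- Christoffel symbols of the first kind at `x` in the preferred chart at `x`:
`(v, a, w) ↦ (∂_a g(v, w) + ∂_v g(a, w) - ∂_w g(v, a)) / 2`. -/
def christoffelLower (g : Metric E M) (x : M) (v : E) : E →L[ℝ] E →L[ℝ] ℝ :=
  (1 / 2 : ℝ) • ((metricDeriv g x).flip v + metricDeriv g x v - ((metricDeriv g x).flip v).flip)

theorem christoffelLower_apply (g : Metric E M) (x : M) (v a w : E) :
    christoffelLower g x v a w =
      (metricDeriv g x a v w + metricDeriv g x v a w - metricDeriv g x w v a) / 2 := by
  simp [christoffelLower]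
  ring

/-- Christoffel symbols `a ↦ Γ_x(a, v)` of the Levi-Civita connection of `g` at `x` in the preferred
chart at `x`: the index of `christoffelLower` is raised with the metric. The tangent space at `x` is
identified with the model space by this chart. -/
def christoffel (g : Metric E M) (x : M) (v : E) : E →L[ℝ] E :=
  ContinuousLinearMap.comp (show (E →L[ℝ] ℝ) →L[ℝ] E from (g.inner x).inverse)
    (christoffelLower g x v)

theorem inner_christoffel (g : Metric E M) (x : M) (v a w : E) :
    g.inner x (christoffel g x v a) w = christoffelLower g x v a w := by
  have h := (inner_isInvertible g x).self_apply_inverse (christoffelLower g x v a)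
  exact congrArg (fun l : E →L[ℝ] ℝ => l w) h

theorem inner_christoffel_right (g : Metric E M) (x : M) (v a w : E) :
    g.inner x w (christoffel g x v a) = christoffelLower g x v a w :=
  (g.symm x _ _).trans (inner_christoffel g x v a w)

theorem localMetric_symm (g : Metric E M) (x : M) (y v w : E) :
    localMetric g x y v w = localMetric g x y w v :=
  g.symm _ _ _

theorem differentiableAt_localMetric (g : Metric E M) (x : M) :
    DifferentiableAt ℝ (E := E) (F := E →L[ℝ] E →L[ℝ] ℝ) (localMetric g x)
      (extChartAt 𝓘(ℝ, E) x x) := by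
  have h := g.contMDiff x
  rw [contMDiffAt_section] at h
  have h2 := h.mdifferentiableAt (by simp)
  have h3 := h2.differentiableWithinAt_writtenInExtChartAt
  simp only [modelWithCornersSelf_coe, Set.range_id, differentiableWithinAt_univ] at h3
  refine h3.congr_of_eventuallyEq ?_
  have hc : ContinuousAt (extChartAt 𝓘(ℝ, E) x).symm (extChartAt 𝓘(ℝ, E) x x) :=
    continuousAt_extChartAt_symm x
  have hb : (extChartAt 𝓘(ℝ, E) x).symm (extChartAt 𝓘(ℝ, E) x x) ∈ (chartTriv E x).baseSet := by
    rw [extChartAt_to_inv]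
    exact mem_baseSet_trivializationAt _ _ _
  filter_upwards [hc.eventually ((chartTriv E x).open_baseSet.mem_nhds hb)] with y hy
  ext v w
  have h4 : (extChartAt 𝓘(ℝ, E) x).symm y ∈ (chartTriv E x).baseSet := hy
  have h5 := inCoordinates_apply_eq₂ (𝕜 := ℝ) (F₁ := E) (F₂ := E) (F₃ := ℝ)
    (E₁ := fun z : M => TangentSpace 𝓘(ℝ, E) z) (E₂ := fun z : M => TangentSpace 𝓘(ℝ, E) z)
    (E₃ := Bundle.Trivial M ℝ) (ϕ := g.inner ((extChartAt 𝓘(ℝ, E) x).symm y)) (v := v) (w := w)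
    h4 h4 (Set.mem_univ _)
  refine Eq.trans ?_ h5.symm
  change g.inner ((extChartAt 𝓘(ℝ, E) x).symm y)
    ((chartTriv E x).symmL ℝ ((extChartAt 𝓘(ℝ, E) x).symm y) v)
    ((chartTriv E x).symmL ℝ ((extChartAt 𝓘(ℝ, E) x).symm y) w) = _
  rw [Trivialization.symmL_apply _ h4, Trivialization.symmL_apply _ h4]
  simp

theorem metricDeriv_symm (g : Metric E M) (x : M) (a v w : E) :
    metricDeriv g x a v w = metricDeriv g x a w v := by
  have h1 : HasFDerivAt (E := E) (F := E →L[ℝ] E →L[ℝ] ℝ) (localMetric g x) (metricDeriv g x)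
    (extChartAt 𝓘(ℝ, E) x x) := (differentiableAt_localMetric g x).hasFDerivAt
  have h2 : ∀ v w : E, HasFDerivAt (E := E) (F := ℝ) (fun y => localMetric g x y v w)
      (((metricDeriv g x).flip v).flip w) (extChartAt 𝓘(ℝ, E) x x) := by
    intro v w
    refine ((h1.clm_apply (hasFDerivAt_const v _)).clm_apply (hasFDerivAt_const w _)).congr_fderiv ?_
    ext a
    simp
  have h3 := (h2 w v).congr_of_eventuallyEq
    (Filter.Eventually.of_forall fun y => localMetric_symm g x y v w)
  exact congrArg (fun D : E →L[ℝ] ℝ => D a) ((h2 v w).unique h3)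

/-- The connection `Γ` is torsion-free. -/
theorem christoffel_symm (g : Metric E M) (x : M) (v a : E) :
    christoffel g x v a = christoffel g x a v := by
  refine (inner_isInvertible g x).injective ?_
  ext w
  refine (inner_christoffel g x v a w).trans (Eq.trans ?_ (inner_christoffel g x a v w).symm)
  have e1 := christoffelLower_apply g x v a w
  have e2 := christoffelLower_apply g x a v w
  rw [e1, e2,
    metricDeriv_symm g x w a v]
  ring

/-- The connection `Γ` is compatible with the metric. -/
theorem christoffel_metric (g : Metric E M) (x : M) (v w a : E) :
    metricDeriv g x a v w =
      g.inner x (christoffel g x v a) w + g.inner x v (christoffel g x w a) := by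
  refine Eq.trans ?_ (congrArg₂ (· + ·) (inner_christoffel g x v a w)
    (inner_christoffel_right g x w a v)).symm
  rw [christoffelLower_apply, christoffelLower_apply, metricDeriv_symm g x v w a, metricDeriv_symm g x w v a,
    metricDeriv_symm g x a w v]
  ring

/-- The connection map `T(TM) → TM` of the Levi-Civita connection of `g`: in the chart of `TM` at
`V` induced by the preferred chart of `M`, it is `(a, b) ↦ b + Γ(a, V)`. Its value on `Y_* a` is
`∇_a Y` for each vector field `Y` (also for vector fields along a map). -/
def leviCivitaMap (g : Metric E M) (V : TangentBundle 𝓘(ℝ, E) M) :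
    TangentSpace (𝓘(ℝ, E).prod 𝓘(ℝ, E)) V →L[ℝ] TangentSpace 𝓘(ℝ, E) V.proj :=
  show E × E →L[ℝ] E from
    ContinuousLinearMap.snd ℝ E E +
      (christoffel g V.proj V.snd).comp (ContinuousLinearMap.fst ℝ E E)

/-- The inclusion `T^⊥ L → TM`. -/
def normalInclusion (g : Metric E M) (f : Immersion E F L M) (θ : NormalBundle g f) :
    TangentBundle 𝓘(ℝ, E) M :=
  ⟨f.map θ.proj, θ.snd⟩

/-- Model with corners of the manifold `T^⊥ L`. -/
abbrev normalI (E F : Type*) [NormedAddCommGroup E] [NormedSpace ℝ E]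
    [NormedAddCommGroup F] [NormedSpace ℝ F] :=
  𝓘(ℝ, F).prod 𝓘(ℝ, NormalModel E F)

/-- The differential `π_*` of the bundle projection `T^⊥ L → L` at `θ`. -/
def projDeriv (g : Metric E M) (f : Immersion E F L M) (θ : NormalBundle g f) :
    TangentSpace (normalI E F) θ →L[ℝ] TangentSpace 𝓘(ℝ, F) θ.proj :=
  mfderiv (normalI E F) 𝓘(ℝ, F) (TotalSpace.proj : NormalBundle g f → L) θ

/-- The connection map `K : T(T^⊥ L) → T^⊥ L` of the normal connection: the normal part of the
Levi-Civita connection map of `M`. Thus `K(ξ_* X)` is the normal part of `∇_X ξ`, that is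
`∇^⊥_X ξ`, for each section `ξ`, and `K` is the canonical isomorphism on vertical vectors. -/
def connectionMap (g : Metric E M) (f : Immersion E F L M) (θ : NormalBundle g f) :
    TangentSpace (normalI E F) θ →L[ℝ] NormalSpace g f θ.proj :=
  (normalPart g f θ.proj).comp ((leviCivitaMap g (normalInclusion g f θ)).comp
    (mfderiv (normalI E F) (𝓘(ℝ, E).prod 𝓘(ℝ, E)) (normalInclusion g f) θ))

/-- `A ↦ (π_* A, K A)`, the splitting into horizontal and vertical parts. -/
def splitting (g : Metric E M) (f : Immersion E F L M) (θ : NormalBundle g f) :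
    TangentSpace (normalI E F) θ →L[ℝ] TangentSpace 𝓘(ℝ, F) θ.proj × NormalSpace g f θ.proj :=
  (projDeriv g f θ).prod (connectionMap g f θ)

theorem contMDiff_normalInclusion (g : Metric E M) (f : Immersion E F L M) :
    ContMDiff (normalI E F) (𝓘(ℝ, E).prod 𝓘(ℝ, E)) ∞ (normalInclusion g f) := by
  intro θ₀
  rw [contMDiffAt_totalSpace]
  have hπ : ContMDiff (normalI E F) 𝓘(ℝ, F) ∞ (TotalSpace.proj : NormalBundle g f → L) :=
    contMDiff_proj _
  refine ⟨(f.contMDiff.comp hπ) θ₀, ?_⟩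
  set x₀ := θ₀.proj with hx₀
  have hdom : ∀ᶠ θ : NormalBundle g f in nhds θ₀, θ.proj ∈ normalDom g f x₀ :=
    hπ.continuous.continuousAt.eventually
      ((isOpen_normalDom g f x₀).mem_nhds (mem_normalDom g f x₀))
  have h1 : ContMDiffAt (normalI E F) 𝓘(ℝ, NormalModel E F × (F →L[ℝ] ℝ) →L[ℝ] E) ∞
      (fun θ : NormalBundle g f => (frameMap g f x₀ θ.proj).inverse) θ₀ := by
    have ha : ContDiffAt ℝ ∞ ContinuousLinearMap.inverse (frameMap g f x₀ x₀) :=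
      ContinuousLinearMap.IsInvertible.contDiffAt_map_inverse (frameMap_self_isInvertible g f x₀)
    have hb : ContMDiffAt 𝓘(ℝ, F) 𝓘(ℝ, E →L[ℝ] NormalModel E F × (F →L[ℝ] ℝ)) ∞
        (frameMap g f x₀) x₀ := (contMDiffOn_frameMap g f x₀).contMDiffAt
          ((isOpen_chartDom f x₀).mem_nhds (mem_normalDom g f x₀).1)
    exact ContMDiffAt.comp θ₀ (ha.contMDiffAt.comp x₀ hb) (hπ θ₀)
  have h2 : ContMDiffAt (normalI E F) 𝓘(ℝ, NormalModel E F) ∞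
      (fun θ : NormalBundle g f => fibreTo g f x₀ θ.proj θ.snd) θ₀ :=
    (contMDiffAt_totalSpace.1 (contMDiff_id (I := normalI E F) (n := ∞) θ₀)).2
  have h3 : ContMDiffAt (normalI E F) 𝓘(ℝ, E) ∞
      (fun θ : NormalBundle g f => (frameMap g f x₀ θ.proj).inverse
        ((ContinuousLinearMap.inl ℝ (NormalModel E F) (F →L[ℝ] ℝ))
          (fibreTo g f x₀ θ.proj θ.snd))) θ₀ :=
    h1.clm_apply ((ContinuousLinearMap.contMDiff _).contMDiffAt.comp θ₀ h2)
  refine h3.congr_of_eventuallyEq ?_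
  filter_upwards [hdom] with θ hθ
  have h4 : f.map θ.proj ∈ (chartTriv E (f.map x₀)).baseSet := hθ.1.2
  have h5 := frameMap_fibre g f hθ θ.snd
  change _ = (frameMap g f x₀ θ.proj).inverse (fibreTo g f x₀ θ.proj θ.snd, 0)
  rw [← h5, ContinuousLinearMap.IsInvertible.inverse_apply_self hθ.2,
    Trivialization.continuousLinearMapAt_apply, Trivialization.linearMapAt_apply, if_pos h4]
  rfl

/-- The derivative of the inclusion of a tangent space in the tangent bundle. -/
theorem hasMFDerivAt_tangentMk (y : M) (v : E) :
    HasMFDerivAt 𝓘(ℝ, E) (𝓘(ℝ, E).prod 𝓘(ℝ, E))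
      (fun u : E => (⟨y, u⟩ : TangentBundle 𝓘(ℝ, E) M)) v (ContinuousLinearMap.inr ℝ E E) := by
  refine ⟨(FiberBundle.continuous_totalSpaceMk E (fun z : M => TangentSpace 𝓘(ℝ, E) z)
    y).continuousAt, ?_⟩
  have h : writtenInExtChartAt 𝓘(ℝ, E) (𝓘(ℝ, E).prod 𝓘(ℝ, E)) v
      (fun u : E => (⟨y, u⟩ : TangentBundle 𝓘(ℝ, E) M)) =
      fun u => (extChartAt 𝓘(ℝ, E) y y, u) := by
    funext u
    change extChartAt (𝓘(ℝ, E).prod 𝓘(ℝ, E)) (⟨y, v⟩ : TangentBundle 𝓘(ℝ, E) M)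
      (⟨y, u⟩ : TangentBundle 𝓘(ℝ, E) M) = _
    rw [FiberBundle.extChartAt]
    refine Prod.ext rfl ?_
    exact (tangentBundleCore 𝓘(ℝ, E) M).coordChange_self (achart E y) y (mem_chart_source E y) u
  rw [h]
  exact ((hasFDerivAt_const _ _).prodMk (hasFDerivAt_id _)).hasFDerivWithinAt

theorem trivializationAt_normal_apply (g : Metric E M) (f : Immersion E F L M) (x : L)
    (θ : NormalBundle g f) :
    (trivializationAt (NormalModel E F) (NormalFibre g f) x θ).2 = fibreTo g f x θ.proj θ.snd := rfl

theorem mdifferentiableAt_fibre (g : Metric E M) (f : Immersion E F L M) (x : L)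
    (c : NormalModel E F) :
    MDifferentiableAt 𝓘(ℝ, NormalModel E F) (normalI E F)
      (fun c => (⟨x, fibreFrom g f x x c⟩ : NormalBundle g f)) c := by
  have : ContMDiffAt 𝓘(ℝ, NormalModel E F) (normalI E F) ∞
      (fun c => (⟨x, fibreFrom g f x x c⟩ : NormalBundle g f)) c := by
    rw [contMDiffAt_totalSpace]
    refine ⟨contMDiffAt_const, ?_⟩
    refine (contMDiffAt_id).congr_of_eventuallyEq (Filter.Eventually.of_forall fun c' => ?_)
    exact fibreTo_fibreFrom g f (mem_normalDom g f x) c'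
  exact this.mdifferentiableAt (by simp)

theorem mdifferentiableAt_localSection (g : Metric E M) (f : Immersion E F L M) (x : L)
    (c : NormalModel E F) :
    MDifferentiableAt 𝓘(ℝ, F) (normalI E F)
      (fun z => (⟨z, fibreFrom g f x z c⟩ : NormalBundle g f)) x := by
  have : ContMDiffAt 𝓘(ℝ, F) (normalI E F) ∞
      (fun z => (⟨z, fibreFrom g f x z c⟩ : NormalBundle g f)) x := by
    rw [contMDiffAt_totalSpace]
    refine ⟨contMDiffAt_id, ?_⟩
    refine (contMDiffAt_const (c := c)).congr_of_eventuallyEq ?_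
    filter_upwards [(isOpen_normalDom g f x).mem_nhds (mem_normalDom g f x)] with z hz
    exact fibreTo_fibreFrom g f hz c
  exact this.mdifferentiableAt (by simp)

theorem mdifferentiableAt_proj_normal (g : Metric E M) (f : Immersion E F L M)
    (θ : NormalBundle g f) :
    MDifferentiableAt (normalI E F) 𝓘(ℝ, F) (TotalSpace.proj : NormalBundle g f → L) θ :=
  (contMDiff_proj (IB := 𝓘(ℝ, F)) (n := ∞) (NormalFibre g f) θ).mdifferentiableAt (by simp)

theorem exists_vertical (g : Metric E M) (f : Immersion E F L M) (θ : NormalBundle g f)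
    (n : NormalSpace g f θ.proj) :
    ∃ A : TangentSpace (normalI E F) θ, projDeriv g f θ A = 0 ∧ connectionMap g f θ A = n := by
  obtain ⟨x, w⟩ := θ
  obtain ⟨c, rfl⟩ : ∃ c, fibreFrom g f x x c = w :=
    ⟨_, fibreFrom_fibreTo g f (mem_normalDom g f x) w⟩
  obtain ⟨b, rfl⟩ : ∃ b, fibreFrom g f x x b = n :=
    ⟨_, fibreFrom_fibreTo g f (mem_normalDom g f x) n⟩
  have hj := (mdifferentiableAt_fibre g f x c).hasMFDerivAt
  refine ⟨mfderiv 𝓘(ℝ, NormalModel E F) (normalI E F)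
      (fun c => (⟨x, fibreFrom g f x x c⟩ : NormalBundle g f)) c b, ?_, ?_⟩
  · have h1 := (mdifferentiableAt_proj_normal g f ⟨x, fibreFrom g f x x c⟩).hasMFDerivAt.comp c hj
    have h2 : HasMFDerivAt 𝓘(ℝ, NormalModel E F) 𝓘(ℝ, F) (fun _ : NormalModel E F => x) c 0 :=
      hasMFDerivAt_const x c
    have h3 := hasMFDerivAt_unique h1 h2
    exact congrArg (fun l : NormalModel E F →L[ℝ] F => l b) h3
  · have hι : MDifferentiableAt (normalI E F) (𝓘(ℝ, E).prod 𝓘(ℝ, E)) (normalInclusion g f)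
        ⟨x, fibreFrom g f x x c⟩ :=
      (contMDiff_normalInclusion g f _).mdifferentiableAt (by simp)
    have h1 := hι.hasMFDerivAt.comp c hj
    let B : NormalModel E F →L[ℝ] E := (NormalSpace g f x).subtypeL.comp (fibreFrom g f x x)
    have h2 := (hasMFDerivAt_tangentMk (f.map x) (B c)).comp c B.hasMFDerivAt
    have h3 := hasMFDerivAt_unique h1 h2
    have h4 : mfderiv (normalI E F) (𝓘(ℝ, E).prod 𝓘(ℝ, E)) (normalInclusion g f)
        ⟨x, fibreFrom g f x x c⟩ (mfderiv 𝓘(ℝ, NormalModel E F) (normalI E F)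
          (fun c => (⟨x, fibreFrom g f x x c⟩ : NormalBundle g f)) c b) = ((0 : E), B b) :=
      congrArg (fun l : NormalModel E F →L[ℝ] E × E => l b) h3
    have h5 : leviCivitaMap g (normalInclusion g f ⟨x, fibreFrom g f x x c⟩) ((0 : E), B b) =
        B b := by
      change B b + christoffel g _ _ (0 : E) = B b
      rw [map_zero, add_zero]
    change normalPart g f x (leviCivitaMap g (normalInclusion g f ⟨x, fibreFrom g f x x c⟩)
      (mfderiv (normalI E F) (𝓘(ℝ, E).prod 𝓘(ℝ, E)) (normalInclusion g f)
        ⟨x, fibreFrom g f x x c⟩ _)) = _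
    rw [h4, h5]
    exact normalPart_coe g f x _

theorem projDeriv_surjective (g : Metric E M) (f : Immersion E F L M) (θ : NormalBundle g f) :
    Function.Surjective (projDeriv g f θ) := by
  obtain ⟨x, w⟩ := θ
  obtain ⟨c, rfl⟩ : ∃ c, fibreFrom g f x x c = w :=
    ⟨_, fibreFrom_fibreTo g f (mem_normalDom g f x) w⟩
  intro X
  have hj := (mdifferentiableAt_localSection g f x c).hasMFDerivAt
  refine ⟨mfderiv 𝓘(ℝ, F) (normalI E F)
      (fun z => (⟨z, fibreFrom g f x z c⟩ : NormalBundle g f)) x X, ?_⟩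
  have h1 := (mdifferentiableAt_proj_normal g f ⟨x, fibreFrom g f x x c⟩).hasMFDerivAt.comp x hj
  have h3 := hasMFDerivAt_unique h1 (hasMFDerivAt_id x)
  exact congrArg (fun l : F →L[ℝ] F => l X) h3

/-- `T_θ(T^⊥ L)` is the direct sum of the horizontal space `ker K` and the vertical space
`ker π_*`, which are mapped isomorphically to `T_x L` by `π_*` and to `T_x^⊥ L` by `K`. -/
theorem splitting_bijective (g : Metric E M) (f : Immersion E F L M) (θ : NormalBundle g f) :
    Function.Bijective (splitting g f θ) := by
  have hs : Function.Surjective (splitting g f θ) := by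
    rintro ⟨X, n⟩
    obtain ⟨A, hA⟩ := projDeriv_surjective g f θ X
    obtain ⟨B, hB1, hB2⟩ := exists_vertical g f θ (n - connectionMap g f θ A)
    refine ⟨A + B, Prod.ext ?_ ?_⟩
    · change projDeriv g f θ (A + B) = X
      rw [map_add, hA, hB1, add_zero]
    · change connectionMap g f θ (A + B) = n
      rw [map_add, hB2, add_sub_cancel]
  have : FiniteDimensional ℝ (TangentSpace (normalI E F) θ) :=
    inferInstanceAs (FiniteDimensional ℝ (F × NormalModel E F))
  have hd : Module.finrank ℝ (TangentSpace (normalI E F) θ) =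
      Module.finrank ℝ (TangentSpace 𝓘(ℝ, F) θ.proj × NormalSpace g f θ.proj) := by
    rw [Module.finrank_prod, finrank_normalSpace]
    change Module.finrank ℝ (F × NormalModel E F) = Module.finrank ℝ F + _
    rw [Module.finrank_prod, finrank_euclideanSpace_fin]
  exact ⟨(LinearMap.injective_iff_surjective_of_finrank_eq_finrank (f := (splitting g f θ).toLinearMap)
    hd).2 hs, hs⟩

/-- The horizontal lift `X^h_θ`: the vector with `π_* X^h_θ = X` and `K X^h_θ = 0`. -/
def horizontalLift (g : Metric E M) (f : Immersion E F L M) (θ : NormalBundle g f)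
    (X : TangentSpace 𝓘(ℝ, F) θ.proj) : TangentSpace (normalI E F) θ :=
  (Equiv.ofBijective _ (splitting_bijective g f θ)).symm (X, 0)

theorem projDeriv_horizontalLift (g : Metric E M) (f : Immersion E F L M) (θ : NormalBundle g f)
    (X : TangentSpace 𝓘(ℝ, F) θ.proj) : projDeriv g f θ (horizontalLift g f θ X) = X :=
  congrArg Prod.fst ((Equiv.ofBijective _ (splitting_bijective g f θ)).apply_symm_apply (X, 0))

theorem connectionMap_horizontalLift (g : Metric E M) (f : Immersion E F L M)
    (θ : NormalBundle g f) (X : TangentSpace 𝓘(ℝ, F) θ.proj) :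
    connectionMap g f θ (horizontalLift g f θ X) = 0 :=
  congrArg Prod.snd ((Equiv.ofBijective _ (splitting_bijective g f θ)).apply_symm_apply (X, 0))

/-- The vertical lift `ξ^v_θ`: the vector with `π_* ξ^v_θ = 0` and `K ξ^v_θ = ξ`. -/
def verticalLift (g : Metric E M) (f : Immersion E F L M) (θ : NormalBundle g f)
    (ξ : NormalSpace g f θ.proj) : TangentSpace (normalI E F) θ :=
  (Equiv.ofBijective _ (splitting_bijective g f θ)).symm (0, ξ)

theorem projDeriv_verticalLift (g : Metric E M) (f : Immersion E F L M) (θ : NormalBundle g f)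
    (ξ : NormalSpace g f θ.proj) : projDeriv g f θ (verticalLift g f θ ξ) = 0 :=
  congrArg Prod.fst ((Equiv.ofBijective _ (splitting_bijective g f θ)).apply_symm_apply (0, ξ))

theorem connectionMap_verticalLift (g : Metric E M) (f : Immersion E F L M)
    (θ : NormalBundle g f) (ξ : NormalSpace g f θ.proj) :
    connectionMap g f θ (verticalLift g f θ ξ) = ξ :=
  congrArg Prod.snd ((Equiv.ofBijective _ (splitting_bijective g f θ)).apply_symm_apply (0, ξ))

/-- The fibre metric `⟨ξ, η⟩^⊥` of the normal bundle. -/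
def normalInner (g : Metric E M) (f : Immersion E F L M) (x : L) (ξ η : NormalSpace g f x) : ℝ :=
  g.inner (f.map x) ξ η

/-- `⟨θ, θ⟩^⊥` for `θ ∈ T^⊥ L`. -/
def normSq (g : Metric E M) (f : Immersion E F L M) (θ : NormalBundle g f) : ℝ :=
  normalInner g f θ.proj θ.snd θ.snd

/-- `ω_θ = 1 / (1 + ⟨θ, θ⟩^⊥)`. -/
def omega (g : Metric E M) (f : Immersion E F L M) (θ : NormalBundle g f) : ℝ :=
  1 / (1 + normSq g f θ)

/-- The generalized Cheeger-Gromoll metric `h_{p,q}` on `T^⊥ L`. -/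
def hpq (g : Metric E M) (f : Immersion E F L M) (p q : ℝ) (θ : NormalBundle g f)
    (A B : TangentSpace (normalI E F) θ) : ℝ :=
  inducedMetric g f θ.proj (projDeriv g f θ A) (projDeriv g f θ B) +
    omega g f θ ^ p *
      (normalInner g f θ.proj (connectionMap g f θ A) (connectionMap g f θ B) +
        q * normalInner g f θ.proj (connectionMap g f θ A) θ.snd *
          normalInner g f θ.proj (connectionMap g f θ B) θ.snd)

end Connection

section AlmostHermitian

variable {E : Type*} [NormedAddCommGroup E] [NormedSpace ℝ E]
  {H : Type*} [TopologicalSpace H] {I : ModelWithCorners ℝ E H}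
  {M : Type*} [TopologicalSpace M] [ChartedSpace H M] [IsManifold I ∞ M]

/-- `(M, g, J)` is almost Hermitian: `J` is a smooth field of endomorphisms of the tangent spaces
with `J² = -1` and `g(J u, J v) = g(u, v)`. -/
structure IsAlmostHermitian
    (g : ContMDiffRiemannianMetric I ∞ E (fun x : M => TangentSpace I x))
    (J : ∀ x : M, TangentSpace I x →L[ℝ] TangentSpace I x) : Prop where
  contMDiff : ContMDiff I (I.prod 𝓘(ℝ, E →L[ℝ] E)) ∞ (fun x => TotalSpace.mk' (E →L[ℝ] E)
    (E := fun x : M => TangentSpace I x →L[ℝ] TangentSpace I x) x (J x))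
  sq : ∀ (x : M) (u : TangentSpace I x), J x (J x u) = -u
  compatible : ∀ (x : M) (u v : TangentSpace I x), g.inner x (J x u) (J x v) = g.inner x u v

end AlmostHermitian

section NaturalStructure

variable {E : Type*} [NormedAddCommGroup E] [NormedSpace ℝ E]
  {M : Type*} [TopologicalSpace M] [ChartedSpace E M]
  {F : Type*} [NormedAddCommGroup F] [NormedSpace ℝ F]
  {L : Type*} [TopologicalSpace L] [ChartedSpace F L]
  [FiniteDimensional ℝ E] [FiniteDimensional ℝ F]
  [IsManifold 𝓘(ℝ, E) ∞ M] [IsManifold 𝓘(ℝ, F) ∞ L]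

/-- `L` is totally real: `T_x M` is the orthogonal direct sum of `T_x L` and `J(T_x L)`. -/
def IsTotallyReal (g : Metric E M) (J : ∀ y : M, TangentSpace 𝓘(ℝ, E) y →L[ℝ] TangentSpace 𝓘(ℝ, E) y)
    (f : Immersion E F L M) : Prop :=
  ∀ x : L, IsCompl (LinearMap.range (f.d x).toLinearMap)
      ((LinearMap.range (f.d x).toLinearMap).map (J (f.map x)).toLinearMap) ∧
    ∀ X Y : TangentSpace 𝓘(ℝ, F) x, g.inner (f.map x) (f.d x X) (J (f.map x) (f.d x Y)) = 0

/-- `J ξ` as a vector of `T_x L`, for `ξ ∈ T_x^⊥ L` (it is the tangential part of `J ξ`; if `L` is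
totally real then `J ξ` is tangent to `L`). -/
def jTangent (g : Metric E M) (J : ∀ y : M, TangentSpace 𝓘(ℝ, E) y →L[ℝ] TangentSpace 𝓘(ℝ, E) y)
    (f : Immersion E F L M) (x : L) (ξ : NormalSpace g f x) : TangentSpace 𝓘(ℝ, F) x :=
  tangentialPart g f x (J (f.map x) ξ)

/-- `J X` as a vector of `T_x^⊥ L`, for `X ∈ T_x L` (it is the normal part of `J X`; if `L` is
totally real then `J X` is normal to `L`). -/
def jNormal (g : Metric E M) (J : ∀ y : M, TangentSpace 𝓘(ℝ, E) y →L[ℝ] TangentSpace 𝓘(ℝ, E) y)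
    (f : Immersion E F L M) (x : L) (X : TangentSpace 𝓘(ℝ, F) x) : NormalSpace g f x :=
  normalPart g f x (J (f.map x) (f.d x X))

/-- `Jt` is the field of endomorphisms `J̃` of the tangent spaces of `T^⊥ L` given, with
`s = √(1 + q⟨θ, θ⟩)`, by
`J̃ ξ^v = ω^(p/2) ((J ξ)^h + q / (1 + s) ⟨ξ, θ⟩ (J θ)^h)` and
`J̃ X^h = ω^(-p/2) ((J X)^v - q / (1 + q⟨θ, θ⟩ + s) ⟨J X, θ⟩ θ^v)`. -/
structure IsNaturalStructure (g : Metric E M)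
    (J : ∀ y : M, TangentSpace 𝓘(ℝ, E) y →L[ℝ] TangentSpace 𝓘(ℝ, E) y)
    (f : Immersion E F L M) (p q : ℝ)
    (Jt : ∀ θ : NormalBundle g f,
      TangentSpace (normalI E F) θ →L[ℝ] TangentSpace (normalI E F) θ) : Prop where
  vertical : ∀ (θ : NormalBundle g f) (ξ : NormalSpace g f θ.proj),
    Jt θ (verticalLift g f θ ξ) =
      omega g f θ ^ (p / 2) •
        (horizontalLift g f θ (jTangent g J f θ.proj ξ) +
          (q / (1 + √(1 + q * normSq g f θ)) * normalInner g f θ.proj ξ θ.snd) •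
            horizontalLift g f θ (jTangent g J f θ.proj θ.snd))
  horizontal : ∀ (θ : NormalBundle g f) (X : TangentSpace 𝓘(ℝ, F) θ.proj),
    Jt θ (horizontalLift g f θ X) =
      (1 / omega g f θ ^ (p / 2)) •
        (verticalLift g f θ (jNormal g J f θ.proj X) -
          (q / (1 + q * normSq g f θ + √(1 + q * normSq g f θ)) *
              normalInner g f θ.proj (jNormal g J f θ.proj X) θ.snd) •
            verticalLift g f θ θ.snd)

end NaturalStructure

end NormalBundleGeometry

end

/-! Pointwise the statement is linear algebra. The splitting `A ↦ (π_* A, K A)` is bijective, and in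
it `J̃` is off-diagonal. Put `t = ⟨θ, θ⟩`, `s = √(1 + q t)`, and let `R ξ = ⟨ξ, θ⟩ θ`. The
vertical-to-horizontal block is `P = ω^(p/2) J (1 + c R)` with `c = q / (1 + s)`; the other block is
`Q = ω^(-p/2) (1 - c' R) J` with `c' = c / s`. As `R` multiplies `θ` by `t` and `q t = s² - 1`, the
factors `1 + c R` and `1 - c' R` multiply `θ` by `s` and `1 / s` and fix its orthogonal complement
in the normal space. They are inverse to each other, and `(1 + c R)² = 1 + q R`. For a totally real
`L`, `J` exchanges `T_x L` and `T_x^⊥ L` isometrically with square `-1`. Hence `P Q = -1` and `Q P =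
-1`, which gives `J̃² = -1`, and `P` is an isometry from the vertical part of `h_{p,q}` to the
induced metric (`inducedMetric_verticalToHorizontal`). Compatibility follows from this isometry and
`P Q = -1`. Existence and uniqueness of `J̃` hold because its values on the two kinds of lifts
amount to prescribing both of its components (`isNaturalStructure_iff`).

Smoothness is the longer half. The map `K` is defined at each point in the preferred chart of that
point, so its regularity is not visible from the definition. The transformation law of the
Christoffel symbols of the first kind (`lowerSymbol_comp`), together with the coordinate change of
`T(TM)`, expresses the Levi-Civita connection map near any point in one fixed chart
(`inner_leviCivitaMap`), whence `contMDiff_leviCivitaMap`. One principle then serves throughout: a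
section is smooth as soon as its products with a local frame, for a smooth nondegenerate form, are
smooth (`contMDiffAt_of_bilin_symmL`). It handles the connection map and the tangential and normal
projections. For `J̃` it is applied with the form `h_{p,q}` itself: `h_{p,q}(J̃ U, V)` is an
expression in `g`, `J`, `ω`, `π_*` and `K`, so the inverse of the splitting never has to be
differentiated. -/

noncomputable section

namespace NormalBundleGeometry

/-! ### Transformation law of Christoffel symbols of the first kind. -/

section CoordinateChange

variable {E : Type*} [NormedAddCommGroup E] [NormedSpace ℝ E]

/-- Christoffel symbols of the first kind of a metric whose first derivatives are `D`. -/
def lowerSymbol (D : E →L[ℝ] E →L[ℝ] E →L[ℝ] ℝ) (v a w : E) : ℝ :=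
  (D a v w + D v a w - D w v a) / 2

set_option synthInstance.maxHeartbeats 400000 in
/-- The transformation law of the Christoffel symbols of the first kind. -/
theorem lowerSymbol_comp {G G' : E → E →L[ℝ] E →L[ℝ] ℝ} {ψ : E → E} {y : E}
    (hψ : ContDiffAt ℝ ∞ ψ y) (hG' : DifferentiableAt ℝ G' (ψ y)) (hG : DifferentiableAt ℝ G y)
    (hsymm : ∀ v w, G' (ψ y) v w = G' (ψ y) w v)
    (h : ∀ᶠ z in nhds y, ∀ v w, G z v w = G' (ψ z) (fderiv ℝ ψ z v) (fderiv ℝ ψ z w))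
    (v a w : E) :
    lowerSymbol (fderiv ℝ G y) v a w =
      lowerSymbol (fderiv ℝ G' (ψ y)) (fderiv ℝ ψ y v) (fderiv ℝ ψ y a) (fderiv ℝ ψ y w) +
        G' (ψ y) (fderiv ℝ (fderiv ℝ ψ) y a v) (fderiv ℝ ψ y w) := by
  have hψ1 : HasFDerivAt ψ (fderiv ℝ ψ y) y :=
    (hψ.differentiableAt (by simp)).hasFDerivAt
  have h2 : (1 + 1 : WithTop ℕ∞) ≤ ∞ := by
    rw [one_add_one_eq_two]
    exact WithTop.coe_le_coe.2 (le_top : (2 : ℕ∞) ≤ ⊤)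
  have hψ2 : HasFDerivAt (fderiv ℝ ψ) (fderiv ℝ (fderiv ℝ ψ) y) y :=
    ((hψ.fderiv_right (m := 1) h2).differentiableAt (by simp)).hasFDerivAt
  have hs : ∀ v w, fderiv ℝ (fderiv ℝ ψ) y v w = fderiv ℝ (fderiv ℝ ψ) y w v :=
    (hψ.isSymmSndFDerivAt (by simpa [one_add_one_eq_two] using h2))
  -- Product rule applied to the pull-back relation `h`, with `v` and `w` held constant.
  have key : ∀ a v w, fderiv ℝ G y a v w =
      fderiv ℝ G' (ψ y) (fderiv ℝ ψ y a) (fderiv ℝ ψ y v) (fderiv ℝ ψ y w) +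
        (G' (ψ y) (fderiv ℝ (fderiv ℝ ψ) y a v) (fderiv ℝ ψ y w) +
          G' (ψ y) (fderiv ℝ ψ y v) (fderiv ℝ (fderiv ℝ ψ) y a w)) := by
    intro a v w
    have e1 := (hG.hasFDerivAt.clm_apply (hasFDerivAt_const v y)).clm_apply (hasFDerivAt_const w y)
    have e0 : HasFDerivAt (fun z => G' (ψ z)) ((fderiv ℝ G' (ψ y)).comp (fderiv ℝ ψ y)) y :=
      HasFDerivAt.comp (E := E) (F := E) (G := E →L[ℝ] E →L[ℝ] ℝ) y hG'.hasFDerivAt hψ1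
    have ev : ∀ u, HasFDerivAt (fun z => fderiv ℝ ψ z u) ((fderiv ℝ (fderiv ℝ ψ) y).flip u) y :=
      fun u => (hψ2.clm_apply (hasFDerivAt_const u y)).congr_fderiv (by ext; simp)
    have e2 := (e0.clm_apply (ev v)).clm_apply (ev w)
    have e3 := e1.unique (e2.congr_of_eventuallyEq (h.mono fun z hz => hz v w))
    have e4 := congrArg (fun l : E →L[ℝ] ℝ => l a) e3
    simp at e4
    rw [e4]
    ring
  -- The alternating sum contains six terms with second derivatives of `ψ`. By the symmetry of the
  -- second derivative and of `G' (ψ y)`, four of them cancel and the other two are equal, which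
  -- absorbs the factor `1 / 2`.
  unfold lowerSymbol
  rw [key, key, key, hs v a, hs w a, hs w v, hsymm (fderiv ℝ ψ y a) _, hsymm (fderiv ℝ ψ y v) _]
  ring

end CoordinateChange

/-! ### Smoothness criteria for sections and bundle maps through local frames. -/

section Bundles

variable {V : Type*} [NormedAddCommGroup V] [NormedSpace ℝ V] [FiniteDimensional ℝ V]
  {W : Type*} [NormedAddCommGroup W] [NormedSpace ℝ W]
  {EB : Type*} [NormedAddCommGroup EB] [NormedSpace ℝ EB] {HB : Type*} [TopologicalSpace HB]
  {IB : ModelWithCorners ℝ EB HB} {B : Type*} [TopologicalSpace B] [ChartedSpace HB B]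
  {EN : Type*} [NormedAddCommGroup EN] [NormedSpace ℝ EN] {HN : Type*} [TopologicalSpace HN]
  {IN : ModelWithCorners ℝ EN HN} {N : Type*} [TopologicalSpace N] [ChartedSpace HN N]
  {E₁ : B → Type*} [∀ x, AddCommGroup (E₁ x)] [∀ x, Module ℝ (E₁ x)]
  [TopologicalSpace (TotalSpace V E₁)] [∀ x, TopologicalSpace (E₁ x)]
  [FiberBundle V E₁] [VectorBundle ℝ V E₁]
  {E₂ : B → Type*} [∀ x, AddCommGroup (E₂ x)] [∀ x, Module ℝ (E₂ x)]
  [TopologicalSpace (TotalSpace W E₂)] [∀ x, TopologicalSpace (E₂ x)]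
  [FiberBundle W E₂] [VectorBundle ℝ W E₂]

/-- A map into linear maps on a finite-dimensional space is smooth if its values are. -/
theorem contMDiffAt_clm_of_apply {C : N → V →L[ℝ] W} {n₀ : N}
    (h : ∀ v, ContMDiffAt IN 𝓘(ℝ, W) ∞ (fun n => C n v) n₀) :
    ContMDiffAt IN 𝓘(ℝ, V →L[ℝ] W) ∞ C n₀ := by
  let b := Module.finBasis ℝ V
  -- Expansion in a basis turns `C` into a finite sum of fixed linear maps applied to the vectors `C
  -- n (b i)`.
  have key : C = fun n => ∑ i, ContinuousLinearMap.smulRightL ℝ V W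
      (LinearMap.toContinuousLinearMap (b.coord i)) (C n (b i)) := by
    funext n
    ext v
    conv_lhs => rw [← b.sum_repr v, map_sum]
    simp
  rw [key]
  refine contMDiffAt_finsetSum fun i _ => ?_
  exact (ContinuousLinearMap.contMDiff _).contMDiffAt.comp n₀ (h (b i))

-- The local frame of the trivialization at `b n₀` has constant coordinates there. It supplies the
-- test vectors of all the criteria below.
omit [FiniteDimensional ℝ V] in
theorem contMDiffAt_symmL_apply [ContMDiffVectorBundle ∞ V E₁ IB]
    {b : N → B} {n₀ : N} (hb : ContMDiffAt IN IB ∞ b n₀) (u : V) :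
    ContMDiffAt IN (IB.prod 𝓘(ℝ, V)) ∞
      (fun n => TotalSpace.mk' V (b n) ((trivializationAt V E₁ (b n₀)).symmL ℝ (b n) u)) n₀ := by
  rw [contMDiffAt_totalSpace]
  refine ⟨hb, (contMDiffAt_const (c := u)).congr_of_eventuallyEq ?_⟩
  filter_upwards [hb.continuousAt.eventually ((trivializationAt V E₁ (b n₀)).open_baseSet.mem_nhds
    (mem_baseSet_trivializationAt V E₁ (b n₀)))] with n hn
  replace hn : b n ∈ (trivializationAt V E₁ (b n₀)).baseSet := hn
  have := (trivializationAt V E₁ (b n₀)).continuousLinearMapAt_symmL (R := ℝ) hn u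
  rwa [Trivialization.continuousLinearMapAt_apply, Trivialization.linearMapAt_apply,
    if_pos hn] at this

/-- A field of linear maps is smooth if it maps the local frames to smooth sections. -/
theorem contMDiffAt_hom_of_symmL [∀ x, IsTopologicalAddGroup (E₂ x)]
    [∀ x, ContinuousSMul ℝ (E₂ x)] {φ : ∀ x, E₁ x →L[ℝ] E₂ x} {x₀ : B}
    (h : ∀ u, ContMDiffAt IB (IB.prod 𝓘(ℝ, W)) ∞
      (fun x => TotalSpace.mk' W x (φ x ((trivializationAt V E₁ x₀).symmL ℝ x u))) x₀) :
    ContMDiffAt IB (IB.prod 𝓘(ℝ, V →L[ℝ] W)) ∞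
      (fun x => TotalSpace.mk' (V →L[ℝ] W) (E := fun x => E₁ x →L[ℝ] E₂ x) x (φ x)) x₀ := by
  rw [contMDiffAt_hom_bundle]
  refine ⟨contMDiffAt_id, contMDiffAt_clm_of_apply fun u => ?_⟩
  have h1 := h u
  rw [contMDiffAt_totalSpace] at h1
  refine h1.2.congr_of_eventuallyEq ?_
  filter_upwards [(trivializationAt V E₁ x₀).open_baseSet.mem_nhds
      (mem_baseSet_trivializationAt V E₁ x₀), (trivializationAt W E₂ x₀).open_baseSet.mem_nhds
      (mem_baseSet_trivializationAt W E₂ x₀)] with x hx hx2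
  change (trivializationAt W E₂ x₀).continuousLinearMapAt ℝ x
    (φ x ((trivializationAt V E₁ x₀).symmL ℝ x u)) = _
  rw [Trivialization.continuousLinearMapAt_apply, Trivialization.linearMapAt_apply, if_pos hx2]

/-- A field of bilinear forms is smooth if its components in the local frames are. -/
theorem contMDiffAt_bilin_of_symmL [∀ x, IsTopologicalAddGroup (E₁ x)]
    [∀ x, ContinuousSMul ℝ (E₁ x)] {G : ∀ x, E₁ x →L[ℝ] E₁ x →L[ℝ] ℝ} {x₀ : B}
    (h : ∀ u v, ContMDiffAt IB 𝓘(ℝ, ℝ) ∞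
      (fun x => G x ((trivializationAt V E₁ x₀).symmL ℝ x u)
        ((trivializationAt V E₁ x₀).symmL ℝ x v)) x₀) :
    ContMDiffAt IB (IB.prod 𝓘(ℝ, V →L[ℝ] V →L[ℝ] ℝ)) ∞
      (fun x => TotalSpace.mk' (V →L[ℝ] V →L[ℝ] ℝ)
        (E := fun x => E₁ x →L[ℝ] E₁ x →L[ℝ] ℝ) x (G x)) x₀ := by
  refine contMDiffAt_hom_of_symmL (E₂ := fun x => E₁ x →L[ℝ] Bundle.Trivial B ℝ x) fun u => ?_
  refine contMDiffAt_hom_of_symmL (E₂ := Bundle.Trivial B ℝ)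
    (φ := fun x => G x ((trivializationAt V E₁ x₀).symmL ℝ x u)) fun v => ?_
  rw [contMDiffAt_section]
  exact h u v

/-- A section is smooth if its products, for a smooth nondegenerate bilinear form, with the
local frame are smooth. -/
theorem contMDiffAt_of_bilin_symmL {b : N → B} {n₀ : N} (hb : ContMDiffAt IN IB ∞ b n₀)
    {Y : ∀ n, E₁ (b n)} {G : ∀ n, E₁ (b n) →L[ℝ] E₁ (b n) →L[ℝ] ℝ}
    (hG : ∀ u v, ContMDiffAt IN 𝓘(ℝ, ℝ) ∞
      (fun n => G n ((trivializationAt V E₁ (b n₀)).symmL ℝ (b n) u)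
        ((trivializationAt V E₁ (b n₀)).symmL ℝ (b n) v)) n₀)
    (hpos : ∀ v, v ≠ 0 → G n₀ v v ≠ 0)
    (hY : ∀ v, ContMDiffAt IN 𝓘(ℝ, ℝ) ∞
      (fun n => G n (Y n) ((trivializationAt V E₁ (b n₀)).symmL ℝ (b n) v)) n₀) :
    ContMDiffAt IN (IB.prod 𝓘(ℝ, V)) ∞ (fun n => TotalSpace.mk' V (b n) (Y n)) n₀ := by
  set e := trivializationAt V E₁ (b n₀) with he
  have hmem : b n₀ ∈ e.baseSet := mem_baseSet_trivializationAt V E₁ (b n₀)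
  -- `A` is the Gram matrix of the frame and `l` collects the products of `Y` with it, so the
  -- coordinates of `Y` are `A⁻¹ l`. Inversion is smooth near an invertible map and invertibility is
  -- an open condition, so nondegeneracy is needed at `n₀` only.
  let A : N → V →L[ℝ] V →L[ℝ] ℝ := fun n =>
    (ContinuousLinearMap.precomp ℝ (e.symmL ℝ (b n))).comp ((G n).comp (e.symmL ℝ (b n)))
  have hA : ContMDiffAt IN 𝓘(ℝ, V →L[ℝ] V →L[ℝ] ℝ) ∞ A n₀ :=
    contMDiffAt_clm_of_apply fun u => contMDiffAt_clm_of_apply fun v => hG u v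
  let l : N → V →L[ℝ] ℝ := fun n => (G n (Y n)).comp (e.symmL ℝ (b n))
  have hl : ContMDiffAt IN 𝓘(ℝ, V →L[ℝ] ℝ) ∞ l n₀ := contMDiffAt_clm_of_apply hY
  have hinv : (A n₀).IsInvertible := by
    refine isInvertible_of_injective _ ?_ (finrank_dual _).symm
    refine (injective_iff_map_eq_zero _).2 fun v hv => ?_
    by_contra h0
    refine hpos (e.symmL ℝ (b n₀) v) (fun h1 => h0 ?_) ?_
    · rw [← e.continuousLinearMapAt_symmL (R := ℝ) hmem v, h1, map_zero]
    · exact congrArg (fun l : V →L[ℝ] ℝ => l v) hv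
  have hAi : ContMDiffAt IN 𝓘(ℝ, (V →L[ℝ] ℝ) →L[ℝ] V) ∞ (fun n => (A n).inverse) n₀ :=
    ContMDiffAt.comp n₀ (ContinuousLinearMap.IsInvertible.contDiffAt_map_inverse
      (n := ∞) hinv).contMDiffAt hA
  rw [contMDiffAt_totalSpace]
  refine ⟨hb, (hAi.clm_apply hl).congr_of_eventuallyEq ?_⟩
  filter_upwards [hb.continuousAt.eventually (e.open_baseSet.mem_nhds hmem),
    hA.continuousAt.eventually (ContinuousLinearEquiv.isOpen.mem_nhds hinv)] with n hn hn2
  replace hn : b n ∈ e.baseSet := hn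
  have h1 : A n (e.continuousLinearMapAt ℝ (b n) (Y n)) = l n := by
    ext v
    change G n (e.symmL ℝ (b n) (e.continuousLinearMapAt ℝ (b n) (Y n))) (e.symmL ℝ (b n) v) =
      G n (Y n) (e.symmL ℝ (b n) v)
    rw [e.symmL_continuousLinearMapAt hn]
  rw [← h1, ContinuousLinearMap.IsInvertible.inverse_apply_self hn2,
    Trivialization.continuousLinearMapAt_apply, Trivialization.linearMapAt_apply, if_pos hn]

end Bundles

/-! ### The Levi-Civita connection map in a fixed chart. -/

section LeviCivita

set_option synthInstance.maxHeartbeats 400000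

variable {E : Type*} [NormedAddCommGroup E] [NormedSpace ℝ E]
  {M : Type*} [TopologicalSpace M] [ChartedSpace E M]
  [FiniteDimensional ℝ E] [IsManifold 𝓘(ℝ, E) ∞ M]

theorem localMetric_apply (g : Metric E M) (x : M) (y v w : E) :
    localMetric g x y v w = g.inner ((extChartAt 𝓘(ℝ, E) x).symm y)
      ((chartTriv E x).symmL ℝ ((extChartAt 𝓘(ℝ, E) x).symm y) v)
      ((chartTriv E x).symmL ℝ ((extChartAt 𝓘(ℝ, E) x).symm y) w) := rfl

/-- Needed away from the centre of the chart: the transition map carries the centre of another chart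
to an arbitrary point of this target. -/
theorem contDiffAt_localMetric (g : Metric E M) (x : M) {y : E}
    (hy : y ∈ (extChartAt 𝓘(ℝ, E) x).target) :
    ContDiffAt ℝ ∞ (E := E) (F := E →L[ℝ] E →L[ℝ] ℝ) (localMetric g x) y := by
  rw [← contMDiffAt_iff_contDiffAt]
  have hs : ContMDiffAt 𝓘(ℝ, E) 𝓘(ℝ, E) ∞ (extChartAt 𝓘(ℝ, E) x).symm y :=
    (contMDiffOn_extChartAt_symm x).contMDiffAt ((isOpen_extChartAt_target x).mem_nhds hy)
  have hb : (extChartAt 𝓘(ℝ, E) x).symm y ∈ (chartTriv E x).baseSet := by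
    have := (extChartAt 𝓘(ℝ, E) x).map_target hy
    rwa [extChartAt_source] at this
  have hv : ∀ v : E, ContMDiffAt 𝓘(ℝ, E) (𝓘(ℝ, E).prod 𝓘(ℝ, E)) ∞
      (fun y => (TotalSpace.mk' E ((extChartAt 𝓘(ℝ, E) x).symm y)
        ((chartTriv E x).symmL ℝ ((extChartAt 𝓘(ℝ, E) x).symm y) v) :
        TotalSpace E (fun z : M => TangentSpace 𝓘(ℝ, E) z))) y := fun v =>
    ((contMDiffOn_symmL_apply x v).contMDiffAt
      ((chartTriv E x).open_baseSet.mem_nhds hb)).comp y hs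
  have hg : ContMDiffAt 𝓘(ℝ, E) (𝓘(ℝ, E).prod 𝓘(ℝ, E →L[ℝ] E →L[ℝ] ℝ)) ∞
      (fun y => TotalSpace.mk' (E →L[ℝ] E →L[ℝ] ℝ)
        (E := fun z : M => TangentSpace 𝓘(ℝ, E) z →L[ℝ] TangentSpace 𝓘(ℝ, E) z →L[ℝ] ℝ)
        ((extChartAt 𝓘(ℝ, E) x).symm y) (g.inner ((extChartAt 𝓘(ℝ, E) x).symm y))) y :=
    ContMDiffAt.comp y (g.contMDiff _) hs
  refine contMDiffAt_clm_of_apply fun v => contMDiffAt_clm_of_apply fun w => ?_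
  have := ContMDiffAt.clm_bundle_apply₂ (F₁ := E) (F₂ := E) (F₃ := ℝ)
    (E₃ := Bundle.Trivial M ℝ) hg (hv v) (hv w)
  rw [contMDiffAt_totalSpace] at this
  exact this.2

/-- The cocycle relation: each `symmL` at `p` is the coordinate change into the preferred chart at
`p`. -/
theorem symmL_tangentCoordChange {x x₀ p : M} (hx : p ∈ (chartTriv E x).baseSet)
    (hx₀ : p ∈ (chartTriv E x₀).baseSet) (v : E) :
    (chartTriv E x₀).symmL ℝ p (tangentCoordChange 𝓘(ℝ, E) x x₀ p v) =
      (chartTriv E x).symmL ℝ p v := by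
  have h1 := TangentBundle.symmL_trivializationAt_eq_core (I := 𝓘(ℝ, E)) (b₀ := x) (b := p) hx
  have h2 := TangentBundle.symmL_trivializationAt_eq_core (I := 𝓘(ℝ, E)) (b₀ := x₀) (b := p) hx₀
  rw [h1, h2]
  exact tangentCoordChange_comp (I := 𝓘(ℝ, E)) (w := x) (x := x₀) (y := p) (z := p)
    ⟨⟨by rwa [extChartAt_source], by rwa [extChartAt_source]⟩, mem_extChartAt_source p⟩

theorem symmL_self (x : M) (v : E) : (chartTriv E x).symmL ℝ x v = v := by
  have h1 := TangentBundle.symmL_trivializationAt_eq_core (I := 𝓘(ℝ, E)) (b₀ := x) (b := x)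
    (mem_chart_source E x)
  rw [h1]
  exact tangentCoordChange_self (I := 𝓘(ℝ, E)) (mem_extChartAt_source x)

/-- The transition map from the preferred chart at `x` to the preferred chart at `x₀`. -/
def transition (E : Type*) [NormedAddCommGroup E] [NormedSpace ℝ E]
    {M : Type*} [TopologicalSpace M] [ChartedSpace E M] (x x₀ : M) : E → E :=
  extChartAt 𝓘(ℝ, E) x₀ ∘ (extChartAt 𝓘(ℝ, E) x).symm

theorem contDiffAt_transition {x x₀ : M} (hx : x ∈ (chartTriv E x₀).baseSet) :
    ContDiffAt ℝ ∞ (transition E x x₀) (extChartAt 𝓘(ℝ, E) x x) := by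
  have h : extChartAt 𝓘(ℝ, E) x x ∈
      ((extChartAt 𝓘(ℝ, E) x).symm ≫ (extChartAt 𝓘(ℝ, E) x₀)).source := by
    rw [PartialEquiv.trans_source'', PartialEquiv.symm_symm, PartialEquiv.symm_target]
    exact Set.mem_image_of_mem _ ⟨mem_extChartAt_source x, by rwa [extChartAt_source]⟩
  have := contDiffWithinAt_ext_coord_change (I := 𝓘(ℝ, E)) (n := ∞) x₀ x h
  rwa [modelWithCornersSelf_coe, Set.range_id, contDiffWithinAt_univ] at this

theorem eventually_chart {x x₀ : M} (hx : x ∈ (chartTriv E x₀).baseSet) :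
    ∀ᶠ z in nhds (extChartAt 𝓘(ℝ, E) x x), z ∈ (extChartAt 𝓘(ℝ, E) x).target ∧
      (extChartAt 𝓘(ℝ, E) x).symm z ∈ (chartTriv E x).baseSet ∧
      (extChartAt 𝓘(ℝ, E) x).symm z ∈ (chartTriv E x₀).baseSet := by
  have h2 : (chartTriv E x₀).baseSet ∈ nhds ((extChartAt 𝓘(ℝ, E) x).symm
      (extChartAt 𝓘(ℝ, E) x x)) := by
    rw [extChartAt_to_inv]
    exact (chartTriv E x₀).open_baseSet.mem_nhds hx
  filter_upwards [extChartAt_target_mem_nhds (I := 𝓘(ℝ, E)) x,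
    (continuousAt_extChartAt_symm (I := 𝓘(ℝ, E)) x).eventually h2] with z hz hz2
  refine ⟨hz, ?_, hz2⟩
  have := (extChartAt 𝓘(ℝ, E) x).map_target hz
  rwa [extChartAt_source] at this

theorem fderiv_transition {x x₀ : M} {z : E} (hz : z ∈ (extChartAt 𝓘(ℝ, E) x).target) :
    fderiv ℝ (transition E x x₀) z =
      tangentCoordChange 𝓘(ℝ, E) x x₀ ((extChartAt 𝓘(ℝ, E) x).symm z) := by
  rw [tangentCoordChange_def, (extChartAt 𝓘(ℝ, E) x).right_inv hz, modelWithCornersSelf_coe,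
    Set.range_id, fderivWithin_univ]
  rfl

theorem fderiv_transition_self (x x₀ : M) :
    fderiv ℝ (transition E x x₀) (extChartAt 𝓘(ℝ, E) x x) =
      tangentCoordChange 𝓘(ℝ, E) x x₀ x := by
  rw [fderiv_transition (mem_extChartAt_target x), extChartAt_to_inv]

/-- The pull-back relation required by `lowerSymbol_comp`: the derivative of the transition map is
the coordinate change of tangent vectors. -/
theorem localMetric_transition (g : Metric E M) {x x₀ : M} {z : E}
    (hz : z ∈ (extChartAt 𝓘(ℝ, E) x).target)
    (hx : (extChartAt 𝓘(ℝ, E) x).symm z ∈ (chartTriv E x).baseSet)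
    (hx₀ : (extChartAt 𝓘(ℝ, E) x).symm z ∈ (chartTriv E x₀).baseSet) (v w : E) :
    localMetric g x z v w = localMetric g x₀ (transition E x x₀ z)
      (fderiv ℝ (transition E x x₀) z v) (fderiv ℝ (transition E x x₀) z w) := by
  have h1 : (extChartAt 𝓘(ℝ, E) x₀).symm (transition E x x₀ z) =
      (extChartAt 𝓘(ℝ, E) x).symm z :=
    (extChartAt 𝓘(ℝ, E) x₀).left_inv (by rwa [extChartAt_source])
  rw [localMetric_apply, localMetric_apply, h1, fderiv_transition hz,
    symmL_tangentCoordChange hx hx₀, symmL_tangentCoordChange hx hx₀]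

theorem christoffelLower_eq_lowerSymbol (g : Metric E M) (x : M) (v a w : E) :
    christoffelLower g x v a w =
      lowerSymbol (fderiv ℝ (E := E) (F := E →L[ℝ] E →L[ℝ] ℝ) (localMetric g x)
        (extChartAt 𝓘(ℝ, E) x x)) v a w :=
  christoffelLower_apply g x v a w

theorem localMetric_self (g : Metric E M) (x : M) (v w : E) :
    localMetric g x (extChartAt 𝓘(ℝ, E) x x) v w = g.inner x v w := by
  rw [localMetric_apply, extChartAt_to_inv]
  rw [symmL_self, symmL_self]

/-- The transition map between the charts of `TM` induced by charts of `M`. -/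
theorem tangent_transition (V V₀ : TangentBundle 𝓘(ℝ, E) M)
    (hV : V.proj ∈ (chartTriv E V₀.proj).baseSet) :
    (extChartAt (𝓘(ℝ, E).prod 𝓘(ℝ, E)) V₀ ∘ (extChartAt (𝓘(ℝ, E).prod 𝓘(ℝ, E)) V).symm)
      =ᶠ[nhds ((extChartAt 𝓘(ℝ, E) V.proj V.proj, V.snd) : E × E)]
      fun r : E × E => (transition E V.proj V₀.proj r.1,
        fderiv ℝ (transition E V.proj V₀.proj) r.1 r.2) := by
  have := (continuous_fst (X := E) (Y := E)).continuousAt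
    (x := ((extChartAt 𝓘(ℝ, E) V.proj V.proj, V.snd) : E × E)) |>.eventually (eventually_chart hV)
  filter_upwards [this] with r hr
  obtain ⟨h1, h2, h3⟩ := hr
  rw [fderiv_transition h1]
  set p := (extChartAt 𝓘(ℝ, E) V.proj).symm r.1 with hp
  have e1 : (extChartAt (𝓘(ℝ, E).prod 𝓘(ℝ, E)) V).symm r =
      (⟨p, (chartTriv E V.proj).symmL ℝ p r.2⟩ : TangentBundle 𝓘(ℝ, E) M) := by
    rw [FiberBundle.extChartAt, Trivialization.symmL_apply _ h2, Trivialization.mk_symm _ h2]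
    rfl
  rw [Function.comp_apply, e1, FiberBundle.extChartAt]
  refine Prod.ext rfl ?_
  change (chartTriv E V₀.proj (⟨p, (chartTriv E V.proj).symmL ℝ p r.2⟩ :
    TangentBundle 𝓘(ℝ, E) M)).2 = _
  rw [← symmL_tangentCoordChange h2 h3]
  have := (chartTriv E V₀.proj).continuousLinearMapAt_symmL (R := ℝ) h3
    (tangentCoordChange 𝓘(ℝ, E) V.proj V₀.proj p r.2)
  rwa [Trivialization.continuousLinearMapAt_apply, Trivialization.linearMapAt_apply,
    if_pos h3] at this

theorem extChartAt_tangent_self (V : TangentBundle 𝓘(ℝ, E) M) :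
    extChartAt (𝓘(ℝ, E).prod 𝓘(ℝ, E)) V V = (extChartAt 𝓘(ℝ, E) V.proj V.proj, V.snd) := by
  rw [FiberBundle.extChartAt]
  refine Prod.ext rfl ?_
  exact (tangentBundleCore 𝓘(ℝ, E) M).coordChange_self (achart E V.proj) V.proj
    (mem_chart_source E V.proj) V.snd

/-- The coordinate changes of the tangent bundle of `TM`. -/
theorem tangent_trivialization_apply (V V₀ : TangentBundle 𝓘(ℝ, E) M)
    (hV : V.proj ∈ (chartTriv E V₀.proj).baseSet) (A : E × E) :
    (trivializationAt (E × E) (fun W : TangentBundle 𝓘(ℝ, E) M =>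
        TangentSpace (𝓘(ℝ, E).prod 𝓘(ℝ, E)) W) V₀).continuousLinearMapAt ℝ V A =
      ((tangentCoordChange 𝓘(ℝ, E) V.proj V₀.proj V.proj A.1,
        fderiv ℝ (fderiv ℝ (transition E V.proj V₀.proj)) (extChartAt 𝓘(ℝ, E) V.proj V.proj)
          A.1 V.snd + tangentCoordChange 𝓘(ℝ, E) V.proj V₀.proj V.proj A.2) : E × E) := by
  have hV' : V ∈ (chartAt (ModelProd E E) V₀).source := by
    rw [TangentBundle.mem_chart_source_iff]
    exact hV
  have h1 := TangentBundle.continuousLinearMapAt_trivializationAt_eq_core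
    (I := 𝓘(ℝ, E).prod 𝓘(ℝ, E)) (b₀ := V₀) (b := V) hV'
  rw [h1]
  -- By `tangent_transition` the change of charts of `TM` is `(y, v) ↦ (ψ y, Dψ_y v)`.
  -- Differentiating its second component in `y` produces the second derivative of `ψ`.
  have h0 : tangentCoordChange (𝓘(ℝ, E).prod 𝓘(ℝ, E)) V V₀ V =
      fderiv ℝ (fun r : E × E => (transition E V.proj V₀.proj r.1,
        fderiv ℝ (transition E V.proj V₀.proj) r.1 r.2))
        ((extChartAt 𝓘(ℝ, E) V.proj V.proj, V.snd) : E × E) := by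
    rw [← (tangent_transition V V₀ hV).fderiv_eq, tangentCoordChange_def, extChartAt_tangent_self,
      ModelWithCorners.range_eq_univ, fderivWithin_univ]
    rfl
  refine (congrArg (fun l : E × E →L[ℝ] E × E => l A) h0).trans ?_
  rw [← fderiv_transition_self]
  set ψ := transition E V.proj V₀.proj
  set y := extChartAt 𝓘(ℝ, E) V.proj V.proj
  have hψ : ContDiffAt ℝ ∞ ψ y := contDiffAt_transition hV
  have h2 : HasFDerivAt ψ (fderiv ℝ ψ y) y := (hψ.differentiableAt (by simp)).hasFDerivAt
  have h3 : HasFDerivAt (fderiv ℝ ψ) (fderiv ℝ (fderiv ℝ ψ) y) y :=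
    ((hψ.fderiv_right (m := ∞) le_rfl).differentiableAt (by simp)).hasFDerivAt
  have h4 : HasFDerivAt (fun r : E × E => ψ r.1)
      ((fderiv ℝ ψ y).comp (ContinuousLinearMap.fst ℝ E E)) (y, V.snd) :=
    HasFDerivAt.comp (x := ((y, V.snd) : E × E)) (g := ψ) h2 hasFDerivAt_fst
  have h5 : HasFDerivAt (fun r : E × E => fderiv ℝ ψ r.1)
      ((fderiv ℝ (fderiv ℝ ψ) y).comp (ContinuousLinearMap.fst ℝ E E)) (y, V.snd) :=
    HasFDerivAt.comp (x := ((y, V.snd) : E × E)) (g := fderiv ℝ ψ) h3 hasFDerivAt_fst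
  have h6 := h4.prodMk (h5.clm_apply (hasFDerivAt_snd (𝕜 := ℝ) (p := ((y, V.snd) : E × E))))
  rw [h6.fderiv]
  refine Prod.ext rfl ?_
  simp [add_comm]
  rfl

/-- The Levi-Civita connection map in an arbitrary chart. -/
theorem inner_leviCivitaMap (g : Metric E M) (V V₀ : TangentBundle 𝓘(ℝ, E) M)
    (hV : V.proj ∈ (chartTriv E V₀.proj).baseSet) (A A' : E × E)
    (hA : A' = (trivializationAt (E × E) (fun W : TangentBundle 𝓘(ℝ, E) M =>
        TangentSpace (𝓘(ℝ, E).prod 𝓘(ℝ, E)) W) V₀).continuousLinearMapAt ℝ V A) (w : E) :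
    g.inner V.proj (leviCivitaMap g V A) ((chartTriv E V₀.proj).symmL ℝ V.proj w) =
      localMetric g V₀.proj (extChartAt 𝓘(ℝ, E) V₀.proj V.proj) A'.2 w +
      lowerSymbol (fderiv ℝ (E := E) (F := E →L[ℝ] E →L[ℝ] ℝ) (localMetric g V₀.proj)
        (extChartAt 𝓘(ℝ, E) V₀.proj V.proj)) (chartTriv E V₀.proj V).2 A'.1 w := by
  rw [tangent_trivialization_apply V V₀ hV, ← fderiv_transition_self] at hA
  subst hA
  obtain ⟨x, v⟩ := V
  change E at v
  obtain ⟨a, b⟩ := A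
  set x₀ := V₀.proj
  change x ∈ (chartTriv E x₀).baseSet at hV
  set w₀ : E := (chartTriv E x₀).symmL ℝ x w with hw₀
  -- `w₀` is the tangent vector at `x` whose coordinates in the fixed chart at `x₀` are `w`.
  have e1 : fderiv ℝ (transition E x x₀) (extChartAt 𝓘(ℝ, E) x x) w₀ = w := by
    rw [fderiv_transition_self, hw₀]
    have h1 := TangentBundle.continuousLinearMapAt_trivializationAt_eq_core (I := 𝓘(ℝ, E))
      (b₀ := x₀) (b := x) hV
    have h2 := (chartTriv E x₀).continuousLinearMapAt_symmL (R := ℝ) hV w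
    rwa [h1] at h2
  have e2 : (chartTriv E x₀ ⟨x, v⟩).2 =
      fderiv ℝ (transition E x x₀) (extChartAt 𝓘(ℝ, E) x x) v := by
    rw [fderiv_transition_self]
    rfl
  have e3 : extChartAt 𝓘(ℝ, E) x₀ x = transition E x x₀ (extChartAt 𝓘(ℝ, E) x x) := by
    change _ = extChartAt 𝓘(ℝ, E) x₀ ((extChartAt 𝓘(ℝ, E) x).symm (extChartAt 𝓘(ℝ, E) x x))
    rw [extChartAt_to_inv]
  have e4 : extChartAt 𝓘(ℝ, E) x₀ x ∈ (extChartAt 𝓘(ℝ, E) x₀).target :=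
    (extChartAt 𝓘(ℝ, E) x₀).map_source (by rwa [extChartAt_source])
  -- In the chart at `x` itself this is the definition; pairing with `w₀` lowers the index, so no
  -- inverse metric remains.
  have hsum : g.inner x (leviCivitaMap g (⟨x, v⟩ : TangentBundle 𝓘(ℝ, E) M) (a, b)) w₀ =
      localMetric g x (extChartAt 𝓘(ℝ, E) x x) b w₀ + christoffelLower g x v a w₀ :=
    (congrArg (fun l : E →L[ℝ] ℝ => l w₀) ((g.inner x).map_add b (christoffel g x v a))).trans
      (congrArg₂ (· + ·) (localMetric_self g x b w₀).symm (inner_christoffel g x v a w₀))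
  have hloc := eventually_chart (E := E) hV
  have key := lowerSymbol_comp (G := localMetric g x) (G' := localMetric g x₀)
    (contDiffAt_transition hV)
    ((contDiffAt_localMetric g x₀ (e3 ▸ e4)).differentiableAt (by simp))
    (differentiableAt_localMetric g x) (localMetric_symm g x₀ _)
    (hloc.mono fun z hz => localMetric_transition g hz.1 hz.2.1 hz.2.2) v a w₀
  have hb := localMetric_transition g hloc.self_of_nhds.1 hloc.self_of_nhds.2.1
    hloc.self_of_nhds.2.2 b w₀
  refine hsum.trans ?_
  -- The second-derivative term from the transformation law is exactly the one contained in the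
  -- fibre component of the transformed vector, so the formula keeps its shape in the chart at `x₀`.
  rw [hb, christoffelLower_eq_lowerSymbol, key]
  simp only [e1, e3]
  rw [e2, map_add, add_apply]
  ring

end LeviCivita

/-! ### Scalar products of sections along a map. -/

section MetricAlong

variable {V : Type*} [NormedAddCommGroup V] [NormedSpace ℝ V]
  {EB : Type*} [NormedAddCommGroup EB] [NormedSpace ℝ EB] {HB : Type*} [TopologicalSpace HB]
  {IB : ModelWithCorners ℝ EB HB} {B : Type*} [TopologicalSpace B] [ChartedSpace HB B]
  {EN : Type*} [NormedAddCommGroup EN] [NormedSpace ℝ EN] {HN : Type*} [TopologicalSpace HN]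
  {IN : ModelWithCorners ℝ EN HN} {N : Type*} [TopologicalSpace N] [ChartedSpace HN N]
  {E₁ : B → Type*} [∀ x, AddCommGroup (E₁ x)] [∀ x, Module ℝ (E₁ x)]
  [TopologicalSpace (TotalSpace V E₁)] [∀ x, TopologicalSpace (E₁ x)]
  [∀ x, IsTopologicalAddGroup (E₁ x)] [∀ x, ContinuousSMul ℝ (E₁ x)]
  [FiberBundle V E₁] [VectorBundle ℝ V E₁]

/-- The scalar product of smooth sections along a map is smooth. -/
theorem contMDiffAt_inner_along (g : ContMDiffRiemannianMetric IB ∞ V E₁)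
    {b : N → B} {n₀ : N} (hb : ContMDiffAt IN IB ∞ b n₀) {X Y : ∀ n, E₁ (b n)}
    (hX : ContMDiffAt IN (IB.prod 𝓘(ℝ, V)) ∞ (fun n => TotalSpace.mk' V (b n) (X n)) n₀)
    (hY : ContMDiffAt IN (IB.prod 𝓘(ℝ, V)) ∞ (fun n => TotalSpace.mk' V (b n) (Y n)) n₀) :
    ContMDiffAt IN 𝓘(ℝ, ℝ) ∞ (fun n => g.inner (b n) (X n) (Y n)) n₀ := by
  have hg : ContMDiffAt IN (IB.prod 𝓘(ℝ, V →L[ℝ] V →L[ℝ] ℝ)) ∞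
      (fun n => TotalSpace.mk' (V →L[ℝ] V →L[ℝ] ℝ)
        (E := fun z => E₁ z →L[ℝ] E₁ z →L[ℝ] ℝ) (b n) (g.inner (b n))) n₀ :=
    ContMDiffAt.comp n₀ (g.contMDiff _) hb
  have := ContMDiffAt.clm_bundle_apply₂ (F₁ := V) (F₂ := V) (F₃ := ℝ)
    (E₃ := Bundle.Trivial B ℝ) hg hX hY
  rw [contMDiffAt_totalSpace] at this
  exact this.2

/-- A section along a map is smooth if its scalar products with the local frame are smooth. -/
theorem contMDiffAt_of_inner_symmL [FiniteDimensional ℝ V] [ContMDiffVectorBundle ∞ V E₁ IB]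
    (g : ContMDiffRiemannianMetric IB ∞ V E₁)
    {b : N → B} {n₀ : N} (hb : ContMDiffAt IN IB ∞ b n₀) {Y : ∀ n, E₁ (b n)}
    (hY : ∀ v, ContMDiffAt IN 𝓘(ℝ, ℝ) ∞
      (fun n => g.inner (b n) (Y n) ((trivializationAt V E₁ (b n₀)).symmL ℝ (b n) v)) n₀) :
    ContMDiffAt IN (IB.prod 𝓘(ℝ, V)) ∞ (fun n => TotalSpace.mk' V (b n) (Y n)) n₀ :=
  contMDiffAt_of_bilin_symmL hb (G := fun n => g.inner (b n))
    (fun u v => contMDiffAt_inner_along g hb (contMDiffAt_symmL_apply hb u)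
      (contMDiffAt_symmL_apply hb v)) (fun v hv => (g.pos _ v hv).ne') hY

end MetricAlong

/-! ### Smooth dependence of Christoffel symbols on all arguments. -/

section LowerSymbol

set_option synthInstance.maxHeartbeats 400000

variable {E : Type*} [NormedAddCommGroup E] [NormedSpace ℝ E]
  {EN : Type*} [NormedAddCommGroup EN] [NormedSpace ℝ EN] {HN : Type*} [TopologicalSpace HN]
  {IN : ModelWithCorners ℝ EN HN} {N : Type*} [TopologicalSpace N] [ChartedSpace HN N]

theorem contMDiffAt_fderiv_apply {W : Type*} [NormedAddCommGroup W] [NormedSpace ℝ W]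
    {G : E → W} {y a : N → E} {n₀ : N} (hG : ContDiffAt ℝ ∞ G (y n₀))
    (hy : ContMDiffAt IN 𝓘(ℝ, E) ∞ y n₀) (ha : ContMDiffAt IN 𝓘(ℝ, E) ∞ a n₀) :
    ContMDiffAt IN 𝓘(ℝ, W) ∞ (fun n => fderiv ℝ G (y n) (a n)) n₀ :=
  ContMDiffAt.clm_apply (ContMDiffAt.comp n₀ (hG.fderiv_right (m := ∞) le_rfl).contMDiffAt hy) ha

theorem contMDiffAt_bilin_apply {G : N → E →L[ℝ] E →L[ℝ] ℝ} {v w : N → E} {n₀ : N}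
    (hG : ContMDiffAt IN 𝓘(ℝ, E →L[ℝ] E →L[ℝ] ℝ) ∞ G n₀)
    (hv : ContMDiffAt IN 𝓘(ℝ, E) ∞ v n₀) (hw : ContMDiffAt IN 𝓘(ℝ, E) ∞ w n₀) :
    ContMDiffAt IN 𝓘(ℝ, ℝ) ∞ (fun n => G n (v n) (w n)) n₀ :=
  (hG.clm_apply hv).clm_apply hw

theorem contMDiffAt_lowerSymbol {G : E → E →L[ℝ] E →L[ℝ] ℝ} {y v a w : N → E} {n₀ : N}
    (hG : ContDiffAt ℝ ∞ G (y n₀)) (hy : ContMDiffAt IN 𝓘(ℝ, E) ∞ y n₀)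
    (hv : ContMDiffAt IN 𝓘(ℝ, E) ∞ v n₀) (ha : ContMDiffAt IN 𝓘(ℝ, E) ∞ a n₀)
    (hw : ContMDiffAt IN 𝓘(ℝ, E) ∞ w n₀) :
    ContMDiffAt IN 𝓘(ℝ, ℝ) ∞ (fun n => lowerSymbol (fderiv ℝ G (y n)) (v n) (a n) (w n)) n₀ := by
  have h1 := contMDiffAt_bilin_apply (contMDiffAt_fderiv_apply hG hy ha) hv hw
  have h2 := contMDiffAt_bilin_apply (contMDiffAt_fderiv_apply hG hy hv) ha hw
  have h3 := contMDiffAt_bilin_apply (contMDiffAt_fderiv_apply hG hy hw) hv ha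
  exact ((h1.add h2).sub h3).div_const 2

end LowerSymbol

/-! ### Smoothness of the Levi-Civita connection map. -/

section LeviCivita

set_option synthInstance.maxHeartbeats 400000

variable {E : Type*} [NormedAddCommGroup E] [NormedSpace ℝ E]
  {M : Type*} [TopologicalSpace M] [ChartedSpace E M]
  [FiniteDimensional ℝ E] [IsManifold 𝓘(ℝ, E) ∞ M]

/-- The connection map `T(TM) → TM` of the Levi-Civita connection is smooth. -/
theorem contMDiff_leviCivitaMap (g : Metric E M) :
    ContMDiff ((𝓘(ℝ, E).prod 𝓘(ℝ, E)).prod 𝓘(ℝ, E × E)) (𝓘(ℝ, E).prod 𝓘(ℝ, E)) ∞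
      (fun z : TangentBundle (𝓘(ℝ, E).prod 𝓘(ℝ, E)) (TangentBundle 𝓘(ℝ, E) M) =>
        (⟨z.proj.proj, leviCivitaMap g z.proj z.snd⟩ : TangentBundle 𝓘(ℝ, E) M)) := by
  intro z₀
  -- The chart at `V₀` stays fixed while `z` varies; only in such a chart can smoothness be read
  -- off.
  set V₀ := z₀.proj with hV₀
  have hπ : ContMDiffAt ((𝓘(ℝ, E).prod 𝓘(ℝ, E)).prod 𝓘(ℝ, E × E)) (𝓘(ℝ, E).prod 𝓘(ℝ, E)) ∞
      (fun z : TangentBundle (𝓘(ℝ, E).prod 𝓘(ℝ, E)) (TangentBundle 𝓘(ℝ, E) M) => z.proj) z₀ :=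
    contMDiff_proj _ z₀
  have hv := (contMDiffAt_totalSpace.1 hπ)
  have hA := (contMDiffAt_totalSpace.1 (contMDiff_id (n := ∞)
    (I := (𝓘(ℝ, E).prod 𝓘(ℝ, E)).prod 𝓘(ℝ, E × E)) z₀)).2
  have hb := hv.1
  have hy : ContMDiffAt ((𝓘(ℝ, E).prod 𝓘(ℝ, E)).prod 𝓘(ℝ, E × E)) 𝓘(ℝ, E) ∞
      (fun z : TangentBundle (𝓘(ℝ, E).prod 𝓘(ℝ, E)) (TangentBundle 𝓘(ℝ, E) M) =>
        extChartAt 𝓘(ℝ, E) V₀.proj z.proj.proj) z₀ :=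
    ContMDiffAt.comp z₀ contMDiffAt_extChartAt hb
  have hG := contDiffAt_localMetric g V₀.proj (mem_extChartAt_target (I := 𝓘(ℝ, E)) V₀.proj)
  have hG1 : ContMDiffAt ((𝓘(ℝ, E).prod 𝓘(ℝ, E)).prod 𝓘(ℝ, E × E)) 𝓘(ℝ, E →L[ℝ] E →L[ℝ] ℝ) ∞
      (fun z : TangentBundle (𝓘(ℝ, E).prod 𝓘(ℝ, E)) (TangentBundle 𝓘(ℝ, E) M) =>
        localMetric g V₀.proj (extChartAt 𝓘(ℝ, E) V₀.proj z.proj.proj)) z₀ :=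
    ContMDiffAt.comp z₀ hG.contMDiffAt hy
  refine contMDiffAt_of_inner_symmL g hb fun w => ?_
  have hA1 := (ContinuousLinearMap.fst ℝ E E).contMDiff.contMDiffAt.comp z₀ hA
  have hA2 := (ContinuousLinearMap.snd ℝ E E).contMDiff.contMDiffAt.comp z₀ hA
  have hw : ContMDiffAt ((𝓘(ℝ, E).prod 𝓘(ℝ, E)).prod 𝓘(ℝ, E × E)) 𝓘(ℝ, E) ∞
      (fun _ : TangentBundle (𝓘(ℝ, E).prod 𝓘(ℝ, E)) (TangentBundle 𝓘(ℝ, E) M) => w) z₀ :=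
    contMDiffAt_const
  refine ((contMDiffAt_bilin_apply hG1 hA2 hw).add
    (contMDiffAt_lowerSymbol hG hy hv.2 hA1 hw)).congr_of_eventuallyEq ?_
  have hnear := hπ.continuousAt.eventually
    ((trivializationAt (E × E) (fun W : TangentBundle 𝓘(ℝ, E) M =>
        TangentSpace (𝓘(ℝ, E).prod 𝓘(ℝ, E)) W) V₀).open_baseSet.mem_nhds
      (mem_baseSet_trivializationAt _ _ V₀))
  have hnear2 := hb.continuousAt.eventually ((chartTriv E V₀.proj).open_baseSet.mem_nhds
      (mem_baseSet_trivializationAt _ _ V₀.proj))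
  filter_upwards [hnear, hnear2] with z hz hz2
  -- Near `z₀` the product with the frame vector `w` is the metric term plus the Christoffel term of
  -- the fixed chart, both already known to be smooth.
  refine inner_leviCivitaMap g z.proj V₀ hz2 z.snd _ ?_ w
  rw [Trivialization.continuousLinearMapAt_apply, Trivialization.linearMapAt_apply]
  exact (if_pos hz).symm

end LeviCivita

/-! ### Smoothness of the projections, of `π_*` and `K`, and of `ω`. -/

section Along

set_option synthInstance.maxHeartbeats 400000

variable {E : Type*} [NormedAddCommGroup E] [NormedSpace ℝ E]
  {M : Type*} [TopologicalSpace M] [ChartedSpace E M]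
  {F : Type*} [NormedAddCommGroup F] [NormedSpace ℝ F]
  {L : Type*} [TopologicalSpace L] [ChartedSpace F L]
  [FiniteDimensional ℝ E] [FiniteDimensional ℝ F]
  [IsManifold 𝓘(ℝ, E) ∞ M] [IsManifold 𝓘(ℝ, F) ∞ L]
  {EN : Type*} [NormedAddCommGroup EN] [NormedSpace ℝ EN] {HN : Type*} [TopologicalSpace HN]
  {IN : ModelWithCorners ℝ EN HN} {N : Type*} [TopologicalSpace N] [ChartedSpace HN N]

theorem contMDiffAt_d (f : Immersion E F L M) {b : N → L} {n₀ : N}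
    {X : ∀ n, TangentSpace 𝓘(ℝ, F) (b n)}
    (hX : ContMDiffAt IN (𝓘(ℝ, F).prod 𝓘(ℝ, F)) ∞
      (fun n => (TotalSpace.mk' F (b n) (X n) : TangentBundle 𝓘(ℝ, F) L)) n₀) :
    ContMDiffAt IN (𝓘(ℝ, E).prod 𝓘(ℝ, E)) ∞
      (fun n => (TotalSpace.mk' E (f.map (b n)) (f.d (b n) (X n)) : TangentBundle 𝓘(ℝ, E) M)) n₀ :=
  (f.contMDiff.contMDiff_tangentMap (m := ∞) le_rfl).contMDiffAt.comp n₀ hX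

/-- By `inner_tangentialPart`, the induced products of the tangential part with a frame of `L` are
products of `S` with the image of that frame in `M`. The induced metric is nondegenerate because `f`
is an immersion. -/
theorem contMDiffAt_tangentialPart (g : Metric E M) (f : Immersion E F L M) {b : N → L} {n₀ : N}
    (hb : ContMDiffAt IN 𝓘(ℝ, F) ∞ b n₀) {S : ∀ n, TangentSpace 𝓘(ℝ, E) (f.map (b n))}
    (hS : ContMDiffAt IN (𝓘(ℝ, E).prod 𝓘(ℝ, E)) ∞
      (fun n => (TotalSpace.mk' E (f.map (b n)) (S n) : TangentBundle 𝓘(ℝ, E) M)) n₀) :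
    ContMDiffAt IN (𝓘(ℝ, F).prod 𝓘(ℝ, F)) ∞
      (fun n => (TotalSpace.mk' F (b n) (tangentialPart g f (b n) (S n)) :
        TangentBundle 𝓘(ℝ, F) L)) n₀ := by
  have hfb : ContMDiffAt IN 𝓘(ℝ, E) ∞ (fun n => f.map (b n)) n₀ :=
    ContMDiffAt.comp n₀ (f.contMDiff _) hb
  have hs : ∀ u : F, ContMDiffAt IN (𝓘(ℝ, E).prod 𝓘(ℝ, E)) ∞
      (fun n => (TotalSpace.mk' E (f.map (b n)) (f.d (b n)
        ((chartTriv F (b n₀)).symmL ℝ (b n) u)) : TangentBundle 𝓘(ℝ, E) M)) n₀ := fun u =>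
    contMDiffAt_d f (contMDiffAt_symmL_apply hb u)
  refine contMDiffAt_of_bilin_symmL hb (G := fun n => inducedMetric g f (b n))
    (fun u v => contMDiffAt_inner_along g hfb (hs u) (hs v)) (fun v hv => ?_) (fun v => ?_)
  · exact (g.pos _ _ fun h0 => hv (f.injective _ (h0.trans (map_zero (f.d (b n₀))).symm))).ne'
  · refine (contMDiffAt_inner_along g hfb hS (hs v)).congr_of_eventuallyEq
      (Filter.Eventually.of_forall fun n => ?_)
    exact inner_tangentialPart g f (b n) (S n) _

/-- Normal vectors are treated as vectors of `TM`, where the normal part is a difference of two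
smooth sections; the trivializations of the normal bundle play no role. -/
theorem contMDiffAt_normalPart (g : Metric E M) (f : Immersion E F L M) {b : N → L} {n₀ : N}
    (hb : ContMDiffAt IN 𝓘(ℝ, F) ∞ b n₀) {S : ∀ n, TangentSpace 𝓘(ℝ, E) (f.map (b n))}
    (hS : ContMDiffAt IN (𝓘(ℝ, E).prod 𝓘(ℝ, E)) ∞
      (fun n => (TotalSpace.mk' E (f.map (b n)) (S n) : TangentBundle 𝓘(ℝ, E) M)) n₀) :
    ContMDiffAt IN (𝓘(ℝ, E).prod 𝓘(ℝ, E)) ∞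
      (fun n => (TotalSpace.mk' E (f.map (b n)) (normalPart g f (b n) (S n) :
        TangentSpace 𝓘(ℝ, E) (f.map (b n))) : TangentBundle 𝓘(ℝ, E) M)) n₀ := by
  have hfb : ContMDiffAt IN 𝓘(ℝ, E) ∞ (fun n => f.map (b n)) n₀ :=
    ContMDiffAt.comp n₀ (f.contMDiff _) hb
  refine contMDiffAt_of_inner_symmL g hfb fun w => ?_
  have hw := contMDiffAt_symmL_apply (E₁ := fun z : M => TangentSpace 𝓘(ℝ, E) z) hfb w
  refine ((contMDiffAt_inner_along g hfb hS hw).sub (contMDiffAt_inner_along g hfb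
    (contMDiffAt_d f (contMDiffAt_tangentialPart g f hb hS)) hw)).congr_of_eventuallyEq
      (Filter.Eventually.of_forall fun n => ?_)
  change g.inner _ (normalPart g f (b n) (S n) : TangentSpace 𝓘(ℝ, E) (f.map (b n))) _ =
    g.inner _ _ _ - g.inner _ _ _
  rw [coe_normalPart, map_sub]
  rfl

theorem contMDiffAt_endomorphism {J : ∀ y : M, TangentSpace 𝓘(ℝ, E) y →L[ℝ] TangentSpace 𝓘(ℝ, E) y}
    (hJ : ContMDiff 𝓘(ℝ, E) (𝓘(ℝ, E).prod 𝓘(ℝ, E →L[ℝ] E)) ∞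
      (fun x => TotalSpace.mk' (E →L[ℝ] E)
        (E := fun x : M => TangentSpace 𝓘(ℝ, E) x →L[ℝ] TangentSpace 𝓘(ℝ, E) x) x (J x)))
    {b : N → M} {n₀ : N} (hb : ContMDiffAt IN 𝓘(ℝ, E) ∞ b n₀)
    {S : ∀ n, TangentSpace 𝓘(ℝ, E) (b n)}
    (hS : ContMDiffAt IN (𝓘(ℝ, E).prod 𝓘(ℝ, E)) ∞
      (fun n => (TotalSpace.mk' E (b n) (S n) : TangentBundle 𝓘(ℝ, E) M)) n₀) :
    ContMDiffAt IN (𝓘(ℝ, E).prod 𝓘(ℝ, E)) ∞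
      (fun n => (TotalSpace.mk' E (b n) (J (b n) (S n)) : TangentBundle 𝓘(ℝ, E) M)) n₀ := by
  have h1 : ContMDiffAt IN (𝓘(ℝ, E).prod 𝓘(ℝ, E →L[ℝ] E)) ∞
      (fun n => TotalSpace.mk' (E →L[ℝ] E)
        (E := fun x : M => TangentSpace 𝓘(ℝ, E) x →L[ℝ] TangentSpace 𝓘(ℝ, E) x)
        (b n) (J (b n))) n₀ :=
    ContMDiffAt.comp n₀ (hJ _) hb
  exact ContMDiffAt.clm_bundle_apply (F₁ := E) (F₂ := E) h1 hS

variable {g : Metric E M} {f : Immersion E F L M}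

theorem contMDiff_normalProj :
    ContMDiff (normalI E F) 𝓘(ℝ, F) ∞ (fun θ : NormalBundle g f => θ.proj) :=
  contMDiff_proj _

theorem contMDiff_footpoint :
    ContMDiff (normalI E F) 𝓘(ℝ, E) ∞ (fun θ : NormalBundle g f => f.map θ.proj) :=
  f.contMDiff.comp contMDiff_normalProj

theorem contMDiffAt_projDeriv {U : ∀ θ : NormalBundle g f, TangentSpace (normalI E F) θ}
    {θ₀ : NormalBundle g f}
    (hU : ContMDiffAt (normalI E F) ((normalI E F).prod 𝓘(ℝ, F × NormalModel E F)) ∞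
      (fun θ => (TotalSpace.mk' (F × NormalModel E F) θ (U θ) :
        TangentBundle (normalI E F) (NormalBundle g f))) θ₀) :
    ContMDiffAt (normalI E F) (𝓘(ℝ, F).prod 𝓘(ℝ, F)) ∞
      (fun θ => (TotalSpace.mk' F θ.proj (projDeriv g f θ (U θ)) :
        TangentBundle 𝓘(ℝ, F) L)) θ₀ :=
  ((contMDiff_normalProj (g := g) (f := f)).contMDiff_tangentMap
    (m := ∞) le_rfl).contMDiffAt.comp θ₀ hU

/-- `K` is a composite of three smooth operations: the differential of the inclusion into `TM`, the
Levi-Civita connection map and the normal projection. -/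
theorem contMDiffAt_connectionMap {U : ∀ θ : NormalBundle g f, TangentSpace (normalI E F) θ}
    {θ₀ : NormalBundle g f}
    (hU : ContMDiffAt (normalI E F) ((normalI E F).prod 𝓘(ℝ, F × NormalModel E F)) ∞
      (fun θ => (TotalSpace.mk' (F × NormalModel E F) θ (U θ) :
        TangentBundle (normalI E F) (NormalBundle g f))) θ₀) :
    ContMDiffAt (normalI E F) (𝓘(ℝ, E).prod 𝓘(ℝ, E)) ∞
      (fun θ => (TotalSpace.mk' E (f.map θ.proj) (connectionMap g f θ (U θ) :
        TangentSpace 𝓘(ℝ, E) (f.map θ.proj)) : TangentBundle 𝓘(ℝ, E) M)) θ₀ := by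
  have h1 := ((contMDiff_normalInclusion g f).contMDiff_tangentMap
    (m := ∞) le_rfl).contMDiffAt.comp θ₀ hU
  have h2 := (contMDiff_leviCivitaMap g).contMDiffAt.comp θ₀ h1
  exact contMDiffAt_normalPart g f contMDiff_normalProj.contMDiffAt
    (S := fun θ => leviCivitaMap g (normalInclusion g f θ)
      (mfderiv (normalI E F) (𝓘(ℝ, E).prod 𝓘(ℝ, E)) (normalInclusion g f) θ (U θ))) h2

theorem contMDiff_tautological :
    ContMDiff (normalI E F) (𝓘(ℝ, E).prod 𝓘(ℝ, E)) ∞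
      (fun θ : NormalBundle g f => (TotalSpace.mk' E (f.map θ.proj)
        (θ.snd : TangentSpace 𝓘(ℝ, E) (f.map θ.proj)) : TangentBundle 𝓘(ℝ, E) M)) :=
  contMDiff_normalInclusion g f

theorem contMDiff_normSq : ContMDiff (normalI E F) 𝓘(ℝ, ℝ) ∞ (normSq g f) := fun θ₀ =>
  contMDiffAt_inner_along g (contMDiff_footpoint θ₀) (contMDiff_tautological θ₀)
    (contMDiff_tautological θ₀)

theorem inner_self_nonneg (g : Metric E M) (y : M) (v : TangentSpace 𝓘(ℝ, E) y) :
    0 ≤ g.inner y v v := by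
  by_cases h : v = 0
  · rw [h, map_zero]
  · exact (g.pos y v h).le

theorem normSq_nonneg (θ : NormalBundle g f) : 0 ≤ normSq g f θ := inner_self_nonneg g _ _

theorem omega_pos (θ : NormalBundle g f) : 0 < omega g f θ :=
  one_div_pos.2 (by linarith [normSq_nonneg θ])

theorem contMDiff_omega : ContMDiff (normalI E F) 𝓘(ℝ, ℝ) ∞ (omega g f) := fun θ₀ => by
  have h1 : ContDiffAt ℝ ∞ (fun t : ℝ => 1 / (1 + t)) (normSq g f θ₀) :=
    contDiffAt_const.div (contDiffAt_const.add contDiffAt_id) (by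
      have := normSq_nonneg θ₀
      positivity)
  exact ContMDiffAt.comp (g := fun t : ℝ => 1 / (1 + t)) θ₀ h1.contMDiffAt (contMDiff_normSq θ₀)

theorem contMDiff_omega_rpow (r : ℝ) :
    ContMDiff (normalI E F) 𝓘(ℝ, ℝ) ∞ (fun θ => omega g f θ ^ r) := fun θ₀ => by
  -- Positivity of `ω` permits every real exponent.
  have h1 : ContDiffAt ℝ ∞ (fun t : ℝ => t ^ r) (omega g f θ₀) :=
    contDiffAt_id.rpow_const_of_ne (omega_pos θ₀).ne'
  exact ContMDiffAt.comp θ₀ h1.contMDiffAt (contMDiff_omega θ₀)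

end Along

/-! ### Boundedness of unit balls of definite forms. -/

/-- The unit ball of a definite form on a finite-dimensional space is bounded. -/
theorem isVonNBounded_of_pos {V : Type*} [NormedAddCommGroup V] [NormedSpace ℝ V]
    [FiniteDimensional ℝ V] (b : V →L[ℝ] V →L[ℝ] ℝ) (hb : ∀ v, v ≠ 0 → 0 < b v v) :
    Bornology.IsVonNBounded ℝ {v : V | b v v < 1} := by
  rw [NormedSpace.isVonNBounded_iff]
  have hc : Continuous fun v : V => b v v := by fun_prop
  -- The unit sphere is empty in the trivial space, so the minimum `m` below requires nontriviality.
  rcases subsingleton_or_nontrivial V with hV | hV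
  · exact Bornology.IsBounded.subset (Bornology.isBounded_singleton (x := (0 : V)))
      fun v _ => Subsingleton.elim _ _
  obtain ⟨u, hu, hmin⟩ := (isCompact_sphere (0 : V) 1).exists_isMinOn
    (NormedSpace.sphere_nonempty.2 zero_le_one) hc.continuousOn
  have hu0 : u ≠ 0 := fun h => by simp [h] at hu
  have hm := hb u hu0
  set m := b u u
  -- Quadratic homogeneity extends the minimum over the unit sphere to all vectors.
  have hle : ∀ v, m * ‖v‖ ^ 2 ≤ b v v := by
    intro v
    by_cases hv : v = 0
    · simp [hv]
    have hn : ‖v‖ ≠ 0 := norm_ne_zero_iff.2 hv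
    have h1 : m ≤ b (‖v‖⁻¹ • v) (‖v‖⁻¹ • v) := hmin (by simp [norm_smul, hn])
    have h2 : b v v = ‖v‖ ^ 2 * b (‖v‖⁻¹ • v) (‖v‖⁻¹ • v) := by
      simp only [map_smul, smul_apply, smul_eq_mul]
      field_simp
    rw [h2, mul_comm]
    gcongr
  -- The radius avoids square roots: `2‖v‖ ≤ 1 + ‖v‖² ≤ 1 + 1 / m`.
  refine (Metric.isBounded_closedBall (x := (0 : V)) (r := 1 + 1 / m)).subset fun v hv => ?_
  have hv : b v v < 1 := hv
  rw [mem_closedBall_zero_iff]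
  have h3 : ‖v‖ ^ 2 ≤ 1 / m := by
    rw [le_div_iff₀ hm]
    linarith [hle v]
  nlinarith [sq_nonneg (‖v‖ - 1), norm_nonneg v]

/-! ### The Riemannian metric `h_{p,q}`. -/

section MetricOnNormalBundle

set_option synthInstance.maxHeartbeats 400000

variable {E : Type*} [NormedAddCommGroup E] [NormedSpace ℝ E]
  {M : Type*} [TopologicalSpace M] [ChartedSpace E M]
  {F : Type*} [NormedAddCommGroup F] [NormedSpace ℝ F]
  {L : Type*} [TopologicalSpace L] [ChartedSpace F L]
  [FiniteDimensional ℝ E] [FiniteDimensional ℝ F]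
  [IsManifold 𝓘(ℝ, E) ∞ M] [IsManifold 𝓘(ℝ, F) ∞ L]

/-- The fibre metric of the normal bundle as a continuous bilinear form. -/
def normalForm (g : Metric E M) (f : Immersion E F L M) (x : L) :
    NormalSpace g f x →L[ℝ] NormalSpace g f x →L[ℝ] ℝ :=
  (ContinuousLinearMap.precomp ℝ (NormalSpace g f x).subtypeL).comp
    ((g.inner (f.map x)).comp (NormalSpace g f x).subtypeL)

theorem normalForm_apply (g : Metric E M) (f : Immersion E F L M) (x : L)
    (ξ η : NormalSpace g f x) : normalForm g f x ξ η = normalInner g f x ξ η := rfl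

/-- `A ↦ ⟨K A, θ⟩`. -/
def radialForm (g : Metric E M) (f : Immersion E F L M) (θ : NormalBundle g f) :
    TangentSpace (normalI E F) θ →L[ℝ] ℝ :=
  (normalForm g f θ.proj θ.snd).comp (connectionMap g f θ)

theorem radialForm_apply (g : Metric E M) (f : Immersion E F L M) (θ : NormalBundle g f)
    (A : TangentSpace (normalI E F) θ) :
    radialForm g f θ A = normalInner g f θ.proj (connectionMap g f θ A) θ.snd :=
  g.symm _ _ _

/-- The metric `h_{p,q}` as a continuous bilinear form. -/
def hpqForm (g : Metric E M) (f : Immersion E F L M) (p q : ℝ) (θ : NormalBundle g f) :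
    TangentSpace (normalI E F) θ →L[ℝ] TangentSpace (normalI E F) θ →L[ℝ] ℝ :=
  (ContinuousLinearMap.precomp ℝ (projDeriv g f θ)).comp
      ((inducedMetric g f θ.proj).comp (projDeriv g f θ)) +
    omega g f θ ^ p •
      ((ContinuousLinearMap.precomp ℝ (connectionMap g f θ)).comp
          ((normalForm g f θ.proj).comp (connectionMap g f θ)) +
        q • (radialForm g f θ).smulRight (radialForm g f θ))

theorem hpqForm_apply (g : Metric E M) (f : Immersion E F L M) (p q : ℝ) (θ : NormalBundle g f)
    (A B : TangentSpace (normalI E F) θ) : hpqForm g f p q θ A B = hpq g f p q θ A B := by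
  change inducedMetric g f θ.proj (projDeriv g f θ A) (projDeriv g f θ B) +
    omega g f θ ^ p * (normalForm g f θ.proj (connectionMap g f θ A) (connectionMap g f θ B) +
      q * (radialForm g f θ A * radialForm g f θ B)) = _
  rw [radialForm_apply, radialForm_apply, normalForm_apply, ← mul_assoc]
  rfl

theorem hpq_symm (g : Metric E M) (f : Immersion E F L M) (p q : ℝ) (θ : NormalBundle g f)
    (A B : TangentSpace (normalI E F) θ) : hpq g f p q θ A B = hpq g f p q θ B A := by
  unfold hpq
  have h1 : inducedMetric g f θ.proj (projDeriv g f θ A) (projDeriv g f θ B) =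
    inducedMetric g f θ.proj (projDeriv g f θ B) (projDeriv g f θ A) := g.symm _ _ _
  have h2 : normalInner g f θ.proj (connectionMap g f θ A) (connectionMap g f θ B) =
    normalInner g f θ.proj (connectionMap g f θ B) (connectionMap g f θ A) := g.symm _ _ _
  rw [h1, h2]
  ring

/-- Both summands are nonnegative, the radial term because `q ≥ 0`. The first is positive unless
`π_* A = 0`, and then bijectivity of the splitting forces `K A ≠ 0`, which makes the second
positive. -/
theorem hpq_pos (g : Metric E M) (f : Immersion E F L M) (p : ℝ) {q : ℝ} (hq : 0 ≤ q)
    (θ : NormalBundle g f) (A : TangentSpace (normalI E F) θ) (hA : A ≠ 0) :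
    0 < hpq g f p q θ A A := by
  unfold hpq
  have hω := Real.rpow_pos_of_pos (omega_pos θ) p
  have h1 : 0 ≤ inducedMetric g f θ.proj (projDeriv g f θ A) (projDeriv g f θ A) :=
    inner_self_nonneg g _ _
  have h2 : 0 ≤ normalInner g f θ.proj (connectionMap g f θ A) (connectionMap g f θ A) :=
    inner_self_nonneg g _ _
  have h3 : 0 ≤ q * normalInner g f θ.proj (connectionMap g f θ A) θ.snd *
      normalInner g f θ.proj (connectionMap g f θ A) θ.snd := by
    rw [mul_assoc]
    exact mul_nonneg hq (mul_self_nonneg _)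
  by_cases hπ : projDeriv g f θ A = 0
  · have hK : connectionMap g f θ A ≠ 0 := fun hK => hA
      ((splitting_bijective g f θ).injective ((Prod.ext hπ hK : splitting g f θ A = 0).trans
        (map_zero _).symm))
    have h4 : 0 < normalInner g f θ.proj (connectionMap g f θ A) (connectionMap g f θ A) :=
      g.pos _ _ fun h => hK (Subtype.ext h)
    have := mul_pos hω (add_pos_of_pos_of_nonneg h4 h3)
    linarith
  · have h4 : 0 < inducedMetric g f θ.proj (projDeriv g f θ A) (projDeriv g f θ A) :=
      g.pos _ _ fun h => hπ (f.injective _ (h.trans (map_zero (f.d θ.proj)).symm))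
    have := mul_nonneg hω.le (add_nonneg h2 h3)
    linarith

/-- Every term is a power of `ω`, a constant, or a scalar product in `TM` of smooth fields along the
footpoint map `θ ↦ f (π θ)`. -/
theorem contMDiffAt_hpq {g : Metric E M} {f : Immersion E F L M} (p q : ℝ)
    {U V : ∀ θ : NormalBundle g f, TangentSpace (normalI E F) θ} {θ₀ : NormalBundle g f}
    (hU : ContMDiffAt (normalI E F) ((normalI E F).prod 𝓘(ℝ, F × NormalModel E F)) ∞
      (fun θ => (TotalSpace.mk' (F × NormalModel E F) θ (U θ) :
        TangentBundle (normalI E F) (NormalBundle g f))) θ₀)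
    (hV : ContMDiffAt (normalI E F) ((normalI E F).prod 𝓘(ℝ, F × NormalModel E F)) ∞
      (fun θ => (TotalSpace.mk' (F × NormalModel E F) θ (V θ) :
        TangentBundle (normalI E F) (NormalBundle g f))) θ₀) :
    ContMDiffAt (normalI E F) 𝓘(ℝ, ℝ) ∞ (fun θ => hpq g f p q θ (U θ) (V θ)) θ₀ := by
  have hb := contMDiff_footpoint (g := g) (f := f) θ₀
  have hKU := contMDiffAt_connectionMap hU
  have hKV := contMDiffAt_connectionMap hV
  have hθ := contMDiff_tautological (g := g) (f := f) θ₀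
  have h1 := contMDiffAt_inner_along g hb (contMDiffAt_d f (contMDiffAt_projDeriv hU))
    (contMDiffAt_d f (contMDiffAt_projDeriv hV))
  have h2 := contMDiffAt_inner_along g hb hKU hKV
  have h3 := contMDiffAt_inner_along g hb hKU hθ
  have h4 := contMDiffAt_inner_along g hb hKV hθ
  have h5 : ContMDiffAt (normalI E F) 𝓘(ℝ, ℝ) ∞ (fun _ : NormalBundle g f => q) θ₀ :=
    contMDiffAt_const
  exact h1.add ((contMDiff_omega_rpow p θ₀).mul (h2.add ((h5.mul h3).mul h4)))

/-- The generalized Cheeger-Gromoll metric as a smooth Riemannian metric on `T^⊥ L`. -/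
def hpqMetric (g : Metric E M) (f : Immersion E F L M) (p : ℝ) {q : ℝ} (hq : 0 ≤ q) :
    ContMDiffRiemannianMetric (normalI E F) ∞ (F × NormalModel E F)
      (fun θ : NormalBundle g f => TangentSpace (normalI E F) θ) where
  inner := hpqForm g f p q
  symm θ A B := by rw [hpqForm_apply, hpqForm_apply, hpq_symm]
  pos θ A hA := by
    rw [hpqForm_apply]
    exact hpq_pos g f p hq θ A hA
  isVonNBounded θ := isVonNBounded_of_pos (V := F × NormalModel E F) (hpqForm g f p q θ)
    fun A hA => (hpq_pos g f p hq θ A hA).trans_eq (hpqForm_apply g f p q θ A A).symm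
  contMDiff θ₀ := by
    refine contMDiffAt_bilin_of_symmL fun u v => ?_
    refine (contMDiffAt_hpq p q (contMDiffAt_symmL_apply contMDiffAt_id u)
      (contMDiffAt_symmL_apply contMDiffAt_id v)).congr_of_eventuallyEq
        (Filter.Eventually.of_forall fun θ => hpqForm_apply g f p q θ _ _)

theorem hpqMetric_inner (g : Metric E M) (f : Immersion E F L M) (p : ℝ) {q : ℝ} (hq : 0 ≤ q)
    (θ : NormalBundle g f) (A B : TangentSpace (normalI E F) θ) :
    (hpqMetric g f p hq).inner θ A B = hpq g f p q θ A B :=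
  hpqForm_apply g f p q θ A B

end MetricOnNormalBundle

/-! ### Pointwise algebra of `J̃`; existence and uniqueness. -/

section NaturalStructureProperties

set_option synthInstance.maxHeartbeats 400000

variable {E : Type*} [NormedAddCommGroup E] [NormedSpace ℝ E]
  {M : Type*} [TopologicalSpace M] [ChartedSpace E M]
  {F : Type*} [NormedAddCommGroup F] [NormedSpace ℝ F]
  {L : Type*} [TopologicalSpace L] [ChartedSpace F L]
  [FiniteDimensional ℝ E] [FiniteDimensional ℝ F]
  [IsManifold 𝓘(ℝ, E) ∞ M] [IsManifold 𝓘(ℝ, F) ∞ L]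
  {g : Metric E M} {J : ∀ y : M, TangentSpace 𝓘(ℝ, E) y →L[ℝ] TangentSpace 𝓘(ℝ, E) y}
  {f : Immersion E F L M}

/-- The orthogonality in the definition of totally real makes `J (df X)` normal already, so the
projection does not change it. -/
theorem coe_jNormal (hL : IsTotallyReal g J f) (x : L) (X : TangentSpace 𝓘(ℝ, F) x) :
    (jNormal g J f x X : TangentSpace 𝓘(ℝ, E) (f.map x)) = J (f.map x) (f.d x X) :=
  congrArg Subtype.val (normalPart_coe g f x ⟨J (f.map x) (f.d x X),
    mem_normalSpace.2 fun Y => (g.symm _ _ _).trans ((hL x).2 Y X)⟩)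

/-- The normal space of a totally real submanifold is the image of the tangent space under `J`. -/
theorem exists_jNormal_eq (hL : IsTotallyReal g J f) (x : L) (ξ : NormalSpace g f x) :
    ∃ X, jNormal g J f x X = ξ := by
  obtain ⟨u, hu, v, hv, huv⟩ := Submodule.mem_sup.1
    ((hL x).1.sup_eq_top.symm ▸ Submodule.mem_top (x := (ξ : TangentSpace 𝓘(ℝ, E) (f.map x))))
  obtain ⟨X, hX⟩ := hu
  obtain ⟨w, ⟨Y, hY⟩, hw⟩ := hv
  have hX : f.d x X = u := hX
  have hY : f.d x Y = w := hY
  have hw : J (f.map x) w = v := hw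
  subst hX hY hw
  refine ⟨Y, Subtype.ext ?_⟩
  rw [coe_jNormal hL]
  -- With `ξ = df X + J (df Y)`, pair with `df X`: both `ξ` and `J (df Y)` are orthogonal to it, so
  -- the tangential summand vanishes.
  have h1 : g.inner (f.map x) (f.d x X) (f.d x X) = 0 := by
    have e1 := mem_normalSpace.1 ξ.2 X
    have e2 := (g.symm _ _ _).trans ((hL x).2 X Y)
    rw [← huv, map_add, add_apply, e2, add_zero] at e1
    exact e1
  have h2 : f.d x X = 0 := by
    by_contra h
    exact (g.pos _ _ h).ne' h1
  rw [← huv, h2, zero_add]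

/-- Since `ξ = J (df X)` for some `X`, the vector `J ξ = -df X` is tangent and equals its tangential
part. -/
theorem d_jTangent (hJ : IsAlmostHermitian g J) (hL : IsTotallyReal g J f) (x : L)
    (ξ : NormalSpace g f x) : f.d x (jTangent g J f x ξ) = J (f.map x) ξ := by
  obtain ⟨X, rfl⟩ := exists_jNormal_eq hL x ξ
  unfold jTangent
  rw [coe_jNormal hL, hJ.sq, map_neg, map_neg]
  have h1 : tangentialPart g f x (f.d x X) = X := by
    refine (inducedMetric_isInvertible g f x).injective ?_
    ext Y
    exact inner_tangentialPart g f x _ Y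
  rw [h1]

theorem jNormal_jTangent (hJ : IsAlmostHermitian g J) (hL : IsTotallyReal g J f) (x : L)
    (ξ : NormalSpace g f x) : jNormal g J f x (jTangent g J f x ξ) = -ξ := by
  apply Subtype.ext
  rw [coe_jNormal hL, d_jTangent hJ hL, hJ.sq]
  rfl

theorem jTangent_jNormal (hJ : IsAlmostHermitian g J) (hL : IsTotallyReal g J f) (x : L)
    (X : TangentSpace 𝓘(ℝ, F) x) : jTangent g J f x (jNormal g J f x X) = -X := by
  apply f.injective x
  change f.d x _ = f.d x (-X)
  rw [d_jTangent hJ hL, coe_jNormal hL, hJ.sq, map_neg]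

theorem inducedMetric_jTangent (hJ : IsAlmostHermitian g J) (hL : IsTotallyReal g J f) (x : L)
    (ξ η : NormalSpace g f x) :
    inducedMetric g f x (jTangent g J f x ξ) (jTangent g J f x η) = normalInner g f x ξ η := by
  rw [inducedMetric_apply, d_jTangent hJ hL, d_jTangent hJ hL, hJ.compatible]
  rfl

/-- `ξ ↦ J ξ` as a linear map `T_x^⊥ L → T_x L`. -/
def jTangentL (g : Metric E M) (J : ∀ y : M, TangentSpace 𝓘(ℝ, E) y →L[ℝ] TangentSpace 𝓘(ℝ, E) y)
    (f : Immersion E F L M) (x : L) : NormalSpace g f x →L[ℝ] TangentSpace 𝓘(ℝ, F) x :=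
  (tangentialPart g f x).comp ((J (f.map x)).comp (NormalSpace g f x).subtypeL)

/-- `X ↦ J X` as a linear map `T_x L → T_x^⊥ L`. -/
def jNormalL (g : Metric E M) (J : ∀ y : M, TangentSpace 𝓘(ℝ, E) y →L[ℝ] TangentSpace 𝓘(ℝ, E) y)
    (f : Immersion E F L M) (x : L) : TangentSpace 𝓘(ℝ, F) x →L[ℝ] NormalSpace g f x :=
  (normalPart g f x).comp ((J (f.map x)).comp (f.d x))

/-- The coefficient `q / (1 + √(1 + q⟨θ, θ⟩))`. -/
def verticalCoeff (g : Metric E M) (f : Immersion E F L M) (q : ℝ) (θ : NormalBundle g f) : ℝ :=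
  q / (1 + √(1 + q * normSq g f θ))

/-- The coefficient `q / (1 + q⟨θ, θ⟩ + √(1 + q⟨θ, θ⟩))`. -/
def horizontalCoeff (g : Metric E M) (f : Immersion E F L M) (q : ℝ) (θ : NormalBundle g f) : ℝ :=
  q / (1 + q * normSq g f θ + √(1 + q * normSq g f θ))

theorem one_le_radicand {q : ℝ} (hq : 0 ≤ q) (θ : NormalBundle g f) :
    1 ≤ 1 + q * normSq g f θ :=
  le_add_of_nonneg_right (mul_nonneg hq (normSq_nonneg θ))

/-- With `s` the square root, `1 + c t = s` and `c' = c / s`. In this form the identity says that `1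
- c' R` inverts `1 + c R`, where `R ξ = ⟨ξ, θ⟩ θ`. -/
theorem coeff_identity {q : ℝ} (hq : 0 ≤ q) (θ : NormalBundle g f) :
    verticalCoeff g f q θ =
      horizontalCoeff g f q θ * (1 + verticalCoeff g f q θ * normSq g f θ) := by
  unfold verticalCoeff horizontalCoeff
  have h1 := one_le_radicand hq θ
  have h2 := Real.sq_sqrt (zero_le_one.trans h1)
  have h3 := Real.sqrt_nonneg (1 + q * normSq g f θ)
  set t := normSq g f θ
  set s := √(1 + q * t)
  have h4 : 1 + s ≠ 0 := by positivity
  have h5 : 1 + q * t + s ≠ 0 := by positivity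
  field_simp
  rw [← h2]
  nlinarith

/-- The coefficient of `R` in `(1 + c R)² = 1 + q R`, using `R² = t R`; this is what fixes the
choice of `c`. -/
theorem verticalCoeff_identity {q : ℝ} (hq : 0 ≤ q) (θ : NormalBundle g f) :
    2 * verticalCoeff g f q θ + verticalCoeff g f q θ ^ 2 * normSq g f θ = q := by
  unfold verticalCoeff
  have h1 := one_le_radicand hq θ
  have h2 := Real.sq_sqrt (zero_le_one.trans h1)
  have h3 := Real.sqrt_nonneg (1 + q * normSq g f θ)
  set t := normSq g f θ
  set s := √(1 + q * t)
  have h4 : 1 + s ≠ 0 := by positivity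
  field_simp
  linear_combination (-q) * h2

/-- The horizontal part of `J̃ A` as a function of the vertical part of `A`. -/
def verticalToHorizontal (g : Metric E M)
    (J : ∀ y : M, TangentSpace 𝓘(ℝ, E) y →L[ℝ] TangentSpace 𝓘(ℝ, E) y)
    (f : Immersion E F L M) (p q : ℝ) (θ : NormalBundle g f) :
    NormalSpace g f θ.proj →L[ℝ] TangentSpace 𝓘(ℝ, F) θ.proj :=
  omega g f θ ^ (p / 2) • (jTangentL g J f θ.proj).comp
    (ContinuousLinearMap.id ℝ _ +
      verticalCoeff g f q θ • (normalForm g f θ.proj θ.snd).smulRight θ.snd)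

/-- The vertical part of `J̃ A` as a function of the horizontal part of `A`. -/
def horizontalToVertical (g : Metric E M)
    (J : ∀ y : M, TangentSpace 𝓘(ℝ, E) y →L[ℝ] TangentSpace 𝓘(ℝ, E) y)
    (f : Immersion E F L M) (p q : ℝ) (θ : NormalBundle g f) :
    TangentSpace 𝓘(ℝ, F) θ.proj →L[ℝ] NormalSpace g f θ.proj :=
  (1 / omega g f θ ^ (p / 2)) • (ContinuousLinearMap.id ℝ _ -
      horizontalCoeff g f q θ • (normalForm g f θ.proj θ.snd).smulRight θ.snd).comp
    (jNormalL g J f θ.proj)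

theorem verticalToHorizontal_apply (p q : ℝ) (θ : NormalBundle g f)
    (ξ : NormalSpace g f θ.proj) :
    verticalToHorizontal g J f p q θ ξ = omega g f θ ^ (p / 2) •
      (jTangent g J f θ.proj ξ + (verticalCoeff g f q θ * normalInner g f θ.proj ξ θ.snd) •
        jTangent g J f θ.proj θ.snd) := by
  change omega g f θ ^ (p / 2) • jTangentL g J f θ.proj
    (ξ + verticalCoeff g f q θ • normalForm g f θ.proj θ.snd ξ • θ.snd) = _
  have h : normalForm g f θ.proj θ.snd ξ = normalInner g f θ.proj ξ θ.snd := g.symm _ _ _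
  rw [h, map_add, map_smul, map_smul, smul_smul]
  rfl

theorem horizontalToVertical_apply (p q : ℝ) (θ : NormalBundle g f)
    (X : TangentSpace 𝓘(ℝ, F) θ.proj) :
    horizontalToVertical g J f p q θ X = (1 / omega g f θ ^ (p / 2)) •
      (jNormal g J f θ.proj X -
        (horizontalCoeff g f q θ * normalInner g f θ.proj (jNormal g J f θ.proj X) θ.snd) •
          θ.snd) := by
  change (1 / omega g f θ ^ (p / 2)) • (jNormal g J f θ.proj X - horizontalCoeff g f q θ •
    normalForm g f θ.proj θ.snd (jNormal g J f θ.proj X) • θ.snd) = _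
  have h : normalForm g f θ.proj θ.snd (jNormal g J f θ.proj X) =
    normalInner g f θ.proj (jNormal g J f θ.proj X) θ.snd := g.symm _ _ _
  rw [h, smul_smul]

theorem tangent_ext {θ : NormalBundle g f} {A B : TangentSpace (normalI E F) θ}
    (h1 : projDeriv g f θ A = projDeriv g f θ B)
    (h2 : connectionMap g f θ A = connectionMap g f θ B) : A = B :=
  (splitting_bijective g f θ).injective (Prod.ext h1 h2)

theorem horizontal_add_vertical {θ : NormalBundle g f} (A : TangentSpace (normalI E F) θ) :
    horizontalLift g f θ (projDeriv g f θ A) + verticalLift g f θ (connectionMap g f θ A) = A := by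
  refine tangent_ext ?_ ?_
  · rw [map_add, projDeriv_horizontalLift, projDeriv_verticalLift, add_zero]
  · rw [map_add, connectionMap_horizontalLift, connectionMap_verticalLift, zero_add]

/-- Every vector is the sum of the lifts of its two components, so the formulas on lifts are
equivalent to formulas for `π_* (J̃ A)` and `K (J̃ A)`. This form contains no lifts and serves for
uniqueness, algebra and smoothness alike. -/
theorem isNaturalStructure_iff {p q : ℝ}
    {Jt : ∀ θ : NormalBundle g f,
      TangentSpace (normalI E F) θ →L[ℝ] TangentSpace (normalI E F) θ} :
    IsNaturalStructure g J f p q Jt ↔ ∀ θ A,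
      projDeriv g f θ (Jt θ A) = verticalToHorizontal g J f p q θ (connectionMap g f θ A) ∧
      connectionMap g f θ (Jt θ A) = horizontalToVertical g J f p q θ (projDeriv g f θ A) := by
  constructor
  · intro h θ A
    have e : Jt θ A = Jt θ (horizontalLift g f θ (projDeriv g f θ A)) +
        Jt θ (verticalLift g f θ (connectionMap g f θ A)) := by
      rw [← map_add, horizontal_add_vertical]
    rw [e, h.vertical, h.horizontal, verticalToHorizontal_apply, horizontalToVertical_apply]
    constructor
    · simp only [map_add, map_smul, map_sub, projDeriv_horizontalLift, projDeriv_verticalLift,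
        smul_zero, sub_zero, zero_add]
      rfl
    · simp only [map_add, map_smul, map_sub, connectionMap_horizontalLift,
        connectionMap_verticalLift, smul_zero, add_zero]
      rfl
  · intro h
    refine ⟨fun θ ξ => tangent_ext ?_ ?_, fun θ X => tangent_ext ?_ ?_⟩
    · rw [(h θ _).1, connectionMap_verticalLift, verticalToHorizontal_apply]
      simp only [map_add, map_smul, projDeriv_horizontalLift]
      rfl
    · rw [(h θ _).2, projDeriv_verticalLift]
      simp only [map_add, map_smul, map_zero, connectionMap_horizontalLift, smul_zero, add_zero]
    · rw [(h θ _).1, connectionMap_horizontalLift]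
      simp only [map_sub, map_smul, map_zero, projDeriv_verticalLift, smul_zero, sub_zero]
    · rw [(h θ _).2, projDeriv_horizontalLift, horizontalToVertical_apply]
      simp only [map_sub, map_smul, connectionMap_verticalLift]
      rfl

theorem verticalToHorizontal_eq_jTangentL (p q : ℝ) (θ : NormalBundle g f)
    (ξ : NormalSpace g f θ.proj) :
    verticalToHorizontal g J f p q θ ξ = omega g f θ ^ (p / 2) • jTangentL g J f θ.proj
      (ξ + (verticalCoeff g f q θ * normalForm g f θ.proj ξ θ.snd) • θ.snd) := by
  rw [verticalToHorizontal_apply, map_add, map_smul]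
  rfl

theorem normalForm_self (θ : NormalBundle g f) :
    normalForm g f θ.proj θ.snd θ.snd = normSq g f θ := rfl

/-- The powers of `ω` cancel, the two copies of `J` give `-1`, and the rank-one corrections are
inverse by `coeff_identity`. -/
theorem horizontalToVertical_verticalToHorizontal (hJ : IsAlmostHermitian g J)
    (hL : IsTotallyReal g J f) (p : ℝ) {q : ℝ} (hq : 0 ≤ q) (θ : NormalBundle g f)
    (ξ : NormalSpace g f θ.proj) :
    horizontalToVertical g J f p q θ (verticalToHorizontal g J f p q θ ξ) = -ξ := by
  have hw := (Real.rpow_pos_of_pos (omega_pos θ) (p / 2)).ne'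
  have h1 : jNormal g J f θ.proj (verticalToHorizontal g J f p q θ ξ) =
      -(omega g f θ ^ (p / 2) •
        (ξ + (verticalCoeff g f q θ * normalForm g f θ.proj ξ θ.snd) • θ.snd)) := by
    rw [verticalToHorizontal_eq_jTangentL]
    refine ((jNormalL g J f θ.proj).map_smul _ _).trans ?_
    rw [← smul_neg]
    have h0 : ∀ x, jNormalL g J f θ.proj (jTangentL g J f θ.proj x) = -x :=
      fun x => jNormal_jTangent hJ hL θ.proj x
    rw [h0]
  have hc := coeff_identity (g := g) (f := f) hq θ
  rw [horizontalToVertical_apply, h1, ← normalForm_apply]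
  simp only [map_neg, map_smul, map_add, neg_apply, smul_apply, add_apply, smul_eq_mul,
    normalForm_self]
  set w := omega g f θ ^ (p / 2)
  set a := normalForm g f θ.proj ξ θ.snd
  -- The coefficient of `ξ` is immediate; that of `θ` is where `coeff_identity` enters.
  match_scalars
  · field_simp
  · field_simp
    linear_combination (-a) * hc

theorem verticalToHorizontal_horizontalToVertical (hJ : IsAlmostHermitian g J)
    (hL : IsTotallyReal g J f) (p : ℝ) {q : ℝ} (hq : 0 ≤ q) (θ : NormalBundle g f)
    (X : TangentSpace 𝓘(ℝ, F) θ.proj) :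
    verticalToHorizontal g J f p q θ (horizontalToVertical g J f p q θ X) = -X := by
  have hw := (Real.rpow_pos_of_pos (omega_pos θ) (p / 2)).ne'
  have hc := coeff_identity (g := g) (f := f) hq θ
  -- Here `1 + c R` acts directly on the output of `1 - c' R`, so the corrections cancel before the
  -- outer `J` is applied.
  have h1 : horizontalToVertical g J f p q θ X + (verticalCoeff g f q θ *
      normalForm g f θ.proj (horizontalToVertical g J f p q θ X) θ.snd) • θ.snd =
      (1 / omega g f θ ^ (p / 2)) • jNormal g J f θ.proj X := by
    rw [horizontalToVertical_apply, ← normalForm_apply]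
    simp only [map_sub, map_smul, sub_apply, smul_apply, smul_eq_mul, normalForm_self]
    set w := omega g f θ ^ (p / 2)
    set b := normalForm g f θ.proj (jNormal g J f θ.proj X) θ.snd
    match_scalars
    · field_simp
    · field_simp
      linear_combination b * hc
  rw [verticalToHorizontal_eq_jTangentL, h1, map_smul, smul_smul, mul_one_div_cancel hw, one_smul]
  exact jTangent_jNormal hJ hL θ.proj X

/-- `J` is an isometry of the normal space onto the tangent space, and the self-adjoint factor `1 +
c R` squares to `1 + q R`. The exponent `p / 2` becomes `p` for the same reason. -/
theorem inducedMetric_verticalToHorizontal (hJ : IsAlmostHermitian g J)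
    (hL : IsTotallyReal g J f) (p : ℝ) {q : ℝ} (hq : 0 ≤ q) (θ : NormalBundle g f)
    (ξ η : NormalSpace g f θ.proj) :
    inducedMetric g f θ.proj (verticalToHorizontal g J f p q θ ξ)
      (verticalToHorizontal g J f p q θ η) = omega g f θ ^ p * (normalInner g f θ.proj ξ η +
        q * normalInner g f θ.proj ξ θ.snd * normalInner g f θ.proj η θ.snd) := by
  have hw : omega g f θ ^ p = omega g f θ ^ (p / 2) * omega g f θ ^ (p / 2) := by
    rw [← Real.rpow_add (omega_pos θ), add_halves]
  have hc := verticalCoeff_identity (g := g) (f := f) hq θ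
  have h1 : ∀ x y : NormalSpace g f θ.proj, inducedMetric g f θ.proj
      (jTangentL g J f θ.proj x) (jTangentL g J f θ.proj y) = normalForm g f θ.proj x y :=
    fun x y => inducedMetric_jTangent hJ hL θ.proj x y
  have h2 : normalForm g f θ.proj θ.snd η = normalForm g f θ.proj η θ.snd := g.symm _ _ _
  simp only [← normalForm_apply]
  rw [verticalToHorizontal_eq_jTangentL, verticalToHorizontal_eq_jTangentL, hw]
  simp only [map_smul, smul_apply, h1, map_add, add_apply, smul_eq_mul, normalForm_self, h2]
  set w := omega g f θ ^ (p / 2)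
  linear_combination w * w * normalForm g f θ.proj ξ θ.snd * normalForm g f θ.proj η θ.snd * hc

/-- The field `J̃`, defined through the splitting of the tangent spaces of `T^⊥ L`. -/
def naturalStructure (g : Metric E M)
    (J : ∀ y : M, TangentSpace 𝓘(ℝ, E) y →L[ℝ] TangentSpace 𝓘(ℝ, E) y)
    (f : Immersion E F L M) (p q : ℝ) (θ : NormalBundle g f) :
    TangentSpace (normalI E F) θ →L[ℝ] TangentSpace (normalI E F) θ :=
  (splitting g f θ).inverse.comp
    (((verticalToHorizontal g J f p q θ).comp (connectionMap g f θ)).prod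
      ((horizontalToVertical g J f p q θ).comp (projDeriv g f θ)))

theorem splitting_isInvertible (θ : NormalBundle g f) : (splitting g f θ).IsInvertible := by
  have : FiniteDimensional ℝ (TangentSpace (normalI E F) θ) :=
    inferInstanceAs (FiniteDimensional ℝ (F × NormalModel E F))
  have : T2Space (TangentSpace (normalI E F) θ) :=
    inferInstanceAs (T2Space (F × NormalModel E F))
  exact isInvertible_of_injective _ (splitting_bijective g f θ).injective
    (LinearEquiv.ofBijective (splitting g f θ).toLinearMap (splitting_bijective g f θ)).finrank_eq

theorem isNaturalStructure_naturalStructure (p q : ℝ) :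
    IsNaturalStructure g J f p q (naturalStructure g J f p q) := by
  rw [isNaturalStructure_iff]
  intro θ A
  have h : splitting g f θ (naturalStructure g J f p q θ A) =
      (verticalToHorizontal g J f p q θ (connectionMap g f θ A),
        horizontalToVertical g J f p q θ (projDeriv g f θ A)) :=
    (splitting_isInvertible θ).self_apply_inverse _
  exact ⟨congrArg Prod.fst h, congrArg Prod.snd h⟩

theorem existsUnique_isNaturalStructure (g : Metric E M)
    (J : ∀ y : M, TangentSpace 𝓘(ℝ, E) y →L[ℝ] TangentSpace 𝓘(ℝ, E) y)
    (f : Immersion E F L M) (p q : ℝ) :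
    ∃! Jt : ∀ θ : NormalBundle g f,
      TangentSpace (normalI E F) θ →L[ℝ] TangentSpace (normalI E F) θ,
      IsNaturalStructure g J f p q Jt := by
  refine ⟨naturalStructure g J f p q, isNaturalStructure_naturalStructure p q, fun Jt h => ?_⟩
  have h1 := isNaturalStructure_iff.1 h
  have h2 := isNaturalStructure_iff.1 (isNaturalStructure_naturalStructure (g := g) (J := J)
    (f := f) p q)
  funext θ
  ext1 A
  exact tangent_ext ((h1 θ A).1.trans (h2 θ A).1.symm) ((h1 θ A).2.trans (h2 θ A).2.symm)

/-- The radicand is at least `1` because `q ≥ 0`, so the square root is smooth and the denominators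
are positive, also on the zero section. -/
theorem contMDiff_coeffs {q : ℝ} (hq : 0 ≤ q) :
    ContMDiff (normalI E F) 𝓘(ℝ, ℝ) ∞ (verticalCoeff g f q) ∧
      ContMDiff (normalI E F) 𝓘(ℝ, ℝ) ∞ (horizontalCoeff g f q) := by
  have h : ∀ θ₀ : NormalBundle g f,
      ContDiffAt ℝ ∞ (fun t : ℝ => q / (1 + √(1 + q * t))) (normSq g f θ₀) ∧
      ContDiffAt ℝ ∞ (fun t : ℝ => q / (1 + q * t + √(1 + q * t))) (normSq g f θ₀) := by
    intro θ₀
    have h1 := one_le_radicand hq θ₀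
    have h2 : ContDiffAt ℝ ∞ (fun t : ℝ => 1 + q * t) (normSq g f θ₀) := by fun_prop
    have h3 := h2.sqrt (zero_lt_one.trans_le h1).ne'
    have h4 := Real.sqrt_nonneg (1 + q * normSq g f θ₀)
    exact ⟨contDiffAt_const.div (contDiffAt_const.add h3) (by positivity),
      contDiffAt_const.div (h2.add h3) (by positivity)⟩
  exact ⟨fun θ₀ => ContMDiffAt.comp (g := fun t : ℝ => q / (1 + √(1 + q * t))) θ₀
      (h θ₀).1.contMDiffAt (contMDiff_normSq θ₀),
    fun θ₀ => ContMDiffAt.comp (g := fun t : ℝ => q / (1 + q * t + √(1 + q * t))) θ₀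
      (h θ₀).2.contMDiffAt (contMDiff_normSq θ₀)⟩

end NaturalStructureProperties

/-! ### Smoothness of `J̃` and compatibility with `h_{p,q}`. -/

section AlmostHermitianStructure

set_option synthInstance.maxHeartbeats 400000

variable {E : Type*} [NormedAddCommGroup E] [NormedSpace ℝ E]
  {M : Type*} [TopologicalSpace M] [ChartedSpace E M]
  {F : Type*} [NormedAddCommGroup F] [NormedSpace ℝ F]
  {L : Type*} [TopologicalSpace L] [ChartedSpace F L]
  [FiniteDimensional ℝ E] [FiniteDimensional ℝ F]
  [IsManifold 𝓘(ℝ, E) ∞ M] [IsManifold 𝓘(ℝ, F) ∞ L]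
  {g : Metric E M} {J : ∀ y : M, TangentSpace 𝓘(ℝ, E) y →L[ℝ] TangentSpace 𝓘(ℝ, E) y}
  {f : Immersion E F L M}

/-- Written entirely with `g` and `J` on `TM`, so that smoothness of each factor along the footpoint
map is known. -/
theorem inducedMetric_verticalToHorizontal_left (hJ : IsAlmostHermitian g J)
    (hL : IsTotallyReal g J f) (p q : ℝ) (θ : NormalBundle g f) (ξ : NormalSpace g f θ.proj)
    (X : TangentSpace 𝓘(ℝ, F) θ.proj) :
    inducedMetric g f θ.proj (verticalToHorizontal g J f p q θ ξ) X =
      omega g f θ ^ (p / 2) * (g.inner (f.map θ.proj) (J (f.map θ.proj) ξ) (f.d θ.proj X) +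
        verticalCoeff g f q θ * g.inner (f.map θ.proj) ξ θ.snd *
          g.inner (f.map θ.proj) (J (f.map θ.proj) θ.snd) (f.d θ.proj X)) := by
  rw [verticalToHorizontal_apply]
  simp only [map_smul, map_add, smul_apply, add_apply, inducedMetric_apply, d_jTangent hJ hL,
    smul_eq_mul]
  rfl

theorem normalInner_horizontalToVertical_left (hL : IsTotallyReal g J f) (p q : ℝ)
    (θ : NormalBundle g f) (X : TangentSpace 𝓘(ℝ, F) θ.proj) (η : NormalSpace g f θ.proj) :
    normalInner g f θ.proj (horizontalToVertical g J f p q θ X) η =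
      1 / omega g f θ ^ (p / 2) * (g.inner (f.map θ.proj) (J (f.map θ.proj) (f.d θ.proj X)) η -
        horizontalCoeff g f q θ *
          g.inner (f.map θ.proj) (J (f.map θ.proj) (f.d θ.proj X)) θ.snd *
          g.inner (f.map θ.proj) θ.snd η) := by
  rw [horizontalToVertical_apply, ← normalForm_apply]
  simp only [map_smul, map_sub, smul_apply, sub_apply, normalForm_apply, smul_eq_mul]
  unfold normalInner
  rw [coe_jNormal hL]

/-- Smoothness of `J̃ U` is not available yet; instead `π_* (J̃ U)` and `K (J̃ U)` are replaced by
their formulas in `K U` and `π_* U`. -/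
theorem contMDiffAt_hpq_natural (hJ : IsAlmostHermitian g J) (hL : IsTotallyReal g J f) {p q : ℝ}
    (hq : 0 ≤ q) {Jt : ∀ θ : NormalBundle g f,
      TangentSpace (normalI E F) θ →L[ℝ] TangentSpace (normalI E F) θ}
    (h : IsNaturalStructure g J f p q Jt)
    {U V : ∀ θ : NormalBundle g f, TangentSpace (normalI E F) θ} {θ₀ : NormalBundle g f}
    (hU : ContMDiffAt (normalI E F) ((normalI E F).prod 𝓘(ℝ, F × NormalModel E F)) ∞
      (fun θ => (TotalSpace.mk' (F × NormalModel E F) θ (U θ) :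
        TangentBundle (normalI E F) (NormalBundle g f))) θ₀)
    (hV : ContMDiffAt (normalI E F) ((normalI E F).prod 𝓘(ℝ, F × NormalModel E F)) ∞
      (fun θ => (TotalSpace.mk' (F × NormalModel E F) θ (V θ) :
        TangentBundle (normalI E F) (NormalBundle g f))) θ₀) :
    ContMDiffAt (normalI E F) 𝓘(ℝ, ℝ) ∞ (fun θ => hpq g f p q θ (Jt θ (U θ)) (V θ)) θ₀ := by
  have hb := contMDiff_footpoint (g := g) (f := f) θ₀
  have hKU := contMDiffAt_connectionMap hU
  have hKV := contMDiffAt_connectionMap hV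
  have hπU := contMDiffAt_d f (contMDiffAt_projDeriv hU)
  have hπV := contMDiffAt_d f (contMDiffAt_projDeriv hV)
  have hθ := contMDiff_tautological (g := g) (f := f) θ₀
  have hJKU := contMDiffAt_endomorphism hJ.contMDiff hb hKU
  have hJπU := contMDiffAt_endomorphism hJ.contMDiff hb hπU
  have hJθ := contMDiffAt_endomorphism hJ.contMDiff hb hθ
  have hω := contMDiff_omega_rpow (g := g) (f := f) (p / 2) θ₀
  have hω' := contMDiff_omega_rpow (g := g) (f := f) (-(p / 2)) θ₀
  have hωp := contMDiff_omega_rpow (g := g) (f := f) p θ₀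
  have hc := (contMDiff_coeffs (g := g) (f := f) hq).1 θ₀
  have hc' := (contMDiff_coeffs (g := g) (f := f) hq).2 θ₀
  have hqc : ContMDiffAt (normalI E F) 𝓘(ℝ, ℝ) ∞ (fun _ : NormalBundle g f => q) θ₀ :=
    contMDiffAt_const
  -- The four factors of `h_{p,q}(J̃ U, V)`: `e1` is the horizontal term, `e2` is `⟨K (J̃ U), K V⟩`,
  -- and `e3`, `e4` are the products of `K (J̃ U)` and `K V` with `θ`.
  have e1 := hω.mul ((contMDiffAt_inner_along g hb hJKU hπV).add
    ((hc.mul (contMDiffAt_inner_along g hb hKU hθ)).mul (contMDiffAt_inner_along g hb hJθ hπV)))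
  have e2 := hω'.mul ((contMDiffAt_inner_along g hb hJπU hKV).sub
    ((hc'.mul (contMDiffAt_inner_along g hb hJπU hθ)).mul (contMDiffAt_inner_along g hb hθ hKV)))
  have e3 := hω'.mul ((contMDiffAt_inner_along g hb hJπU hθ).sub
    ((hc'.mul (contMDiffAt_inner_along g hb hJπU hθ)).mul (contMDiffAt_inner_along g hb hθ hθ)))
  have e4 := contMDiffAt_inner_along g hb hKV hθ
  refine (e1.add (hωp.mul (e2.add ((hqc.mul e3).mul e4)))).congr_of_eventuallyEq
    (Filter.Eventually.of_forall fun θ => ?_)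
  have h1 := isNaturalStructure_iff.1 h θ (U θ)
  have h2 : 1 / omega g f θ ^ (p / 2) = omega g f θ ^ (-(p / 2)) := by
    rw [Real.rpow_neg (omega_pos θ).le, one_div]
  change hpq g f p q θ (Jt θ (U θ)) (V θ) = _
  unfold hpq
  rw [h1.1, h1.2, inducedMetric_verticalToHorizontal_left hJ hL,
    normalInner_horizontalToVertical_left hL, normalInner_horizontalToVertical_left hL, h2]
  rfl

/-- `(T^⊥ L, h_{p,q}, J̃)` is almost Hermitian. -/
theorem isAlmostHermitian_of_isNaturalStructure (hJ : IsAlmostHermitian g J)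
    (hL : IsTotallyReal g J f) {p q : ℝ} (hq : 0 ≤ q)
    {Jt : ∀ θ : NormalBundle g f,
      TangentSpace (normalI E F) θ →L[ℝ] TangentSpace (normalI E F) θ}
    (h : IsNaturalStructure g J f p q Jt) : IsAlmostHermitian (hpqMetric g f p hq) Jt := by
  have hN := isNaturalStructure_iff.1 h
  refine ⟨fun θ₀ => ?_, fun θ A => ?_, fun θ A B => ?_⟩
  · refine contMDiffAt_hom_of_symmL fun u => ?_
    -- The image of a frame vector under `J̃` is tested against the frame with the new metric
    -- itself.
    refine contMDiffAt_of_inner_symmL (hpqMetric g f p hq) contMDiffAt_id fun v => ?_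
    refine (contMDiffAt_hpq_natural hJ hL hq h (contMDiffAt_symmL_apply contMDiffAt_id u)
      (contMDiffAt_symmL_apply contMDiffAt_id v)).congr_of_eventuallyEq
        (Filter.Eventually.of_forall fun θ => hpqMetric_inner g f p hq θ _ _)
  · refine tangent_ext ?_ ?_
    · rw [(hN θ _).1, (hN θ _).2, verticalToHorizontal_horizontalToVertical hJ hL p hq, map_neg]
    · rw [(hN θ _).2, (hN θ _).1, horizontalToVertical_verticalToHorizontal hJ hL p hq, map_neg]
  · rw [hpqMetric_inner, hpqMetric_inner]
    unfold hpq
    -- The isometry property is used twice: forwards it turns the horizontal term into the vertical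
    -- term of `h_{p,q}(A, B)`; backwards, with `P Q = -1`, it turns the vertical term into the
    -- horizontal one, the two signs cancelling.
    rw [(hN θ A).1, (hN θ A).2, (hN θ B).1, (hN θ B).2,
      inducedMetric_verticalToHorizontal hJ hL p hq θ (connectionMap g f θ A),
      ← inducedMetric_verticalToHorizontal hJ hL p hq θ
        (horizontalToVertical g J f p q θ (projDeriv g f θ A)),
      verticalToHorizontal_horizontalToVertical hJ hL p hq,
      verticalToHorizontal_horizontalToVertical hJ hL p hq]
    simp only [map_neg, neg_apply, neg_neg]
    ring

end AlmostHermitianStructure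

end NormalBundleGeometry

end

/-! ### The theorem. -/

theorem mainTheorem7
    {E : Type*} [NormedAddCommGroup E] [NormedSpace ℝ E] [FiniteDimensional ℝ E]
    {M : Type*} [TopologicalSpace M] [ChartedSpace E M] [IsManifold 𝓘(ℝ, E) ∞ M]
    {F : Type*} [NormedAddCommGroup F] [NormedSpace ℝ F] [FiniteDimensional ℝ F]
    {L : Type*} [TopologicalSpace L] [ChartedSpace F L] [IsManifold 𝓘(ℝ, F) ∞ L]
    (k : ℕ) (hE : Module.finrank ℝ E = 2 * k) (hF : Module.finrank ℝ F = k)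
    (g : NormalBundleGeometry.Metric E M)
    (J : ∀ y : M, TangentSpace 𝓘(ℝ, E) y →L[ℝ] TangentSpace 𝓘(ℝ, E) y)
    (hJ : NormalBundleGeometry.IsAlmostHermitian g J)
    (f : NormalBundleGeometry.Immersion E F L M)
    (hL : NormalBundleGeometry.IsTotallyReal g J f)
    (p q : ℝ) (hq : 0 ≤ q) :
    ∃ h : Bundle.ContMDiffRiemannianMetric (NormalBundleGeometry.normalI E F) ∞
        (F × NormalBundleGeometry.NormalModel E F)
        (fun θ : NormalBundleGeometry.NormalBundle g f =>
          TangentSpace (NormalBundleGeometry.normalI E F) θ),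
      (∀ (θ : NormalBundleGeometry.NormalBundle g f)
        (A B : TangentSpace (NormalBundleGeometry.normalI E F) θ),
        h.inner θ A B = NormalBundleGeometry.hpq g f p q θ A B) ∧
      (∃! Jt : ∀ θ : NormalBundleGeometry.NormalBundle g f,
        TangentSpace (NormalBundleGeometry.normalI E F) θ →L[ℝ]
          TangentSpace (NormalBundleGeometry.normalI E F) θ,
        NormalBundleGeometry.IsNaturalStructure g J f p q Jt) ∧
      ∀ Jt : ∀ θ : NormalBundleGeometry.NormalBundle g f,
        TangentSpace (NormalBundleGeometry.normalI E F) θ →L[ℝ]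
          TangentSpace (NormalBundleGeometry.normalI E F) θ,
        NormalBundleGeometry.IsNaturalStructure g J f p q Jt →
          NormalBundleGeometry.IsAlmostHermitian h Jt := by
  exact ⟨NormalBundleGeometry.hpqMetric g f p hq,
    NormalBundleGeometry.hpqMetric_inner g f p hq,
    NormalBundleGeometry.existsUnique_isNaturalStructure g J f p q,
    fun _ h => NormalBundleGeometry.isAlmostHermitian_of_isNaturalStructure hJ hL hq h⟩
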